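/- Let $(\mathcal X,d)$ be a complete separable metric space, $K\ge 2$, $[K]=\{1,\dots,K\}$, and let $\mu$ be a finite positive Borel measure on $\mathcal Z=\mathcal X\times[K]$, with $\mu_i(E)=\mu(E\times\{i\})$. Let $c:\mathcal X\times\mathcal X\to[0,\infty]$ be lower semicontinuous with $c(x,x)=0$ for all $x$, and such that whenever $(x_n)$ is a bounded sequence and $\sup_n c(x_n',x_n)<\infty$, the sequence $(x_n',x_n)$ is precompact in $\mathcal X\times\mathcal X$. For finite measures $\rho,\nu$ on $\mathcal X$ put $C(\rho,\nu)=\inf_{\pi}\int c(x',x)\,d\pi(x',x)$ over couplings $\pi$ with first marginal $\rho$ and second marginal $\nu$ ($+\infty$ if there are none); for finite measures on $\mathcal Z$ define $C$ likewise with the cost equal to $c(x',x)$ if the labels of $(x',i'),(x,i)$ agree and to $+\infty$ otherwise. All measures below are finite and positive; $0\cdot\infty=0$; $S_K$ is the set of nonempty subsets of $[K]$; $P_i$ is the projection onto the $i$-th coordinate. For $A\in S_K$ let $$c_A(x_1,\dots,x_K)=\inf_{x'\in\mathcal X}\sum_{i\in A}c(x',x_i),\qquad T_A(x_1,\dots,x_K)=\operatorname*{argmin}_{x'\in\mathcal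 X}\sum_{i\in A}c(x',x_i),$$ $$\tilde c\big((x_1,r_1),\dots,(x_K,r_K)\big)=\inf\Big\{\sum_{A\in S_K}m_A\,(c_A(x_1,\dots,x_K)+1)\;:\; m_A\ge 0,\ \sum_{A\ni i}m_A=r_i\ \text{for all } i\in[K]\Big\}.$$ Consider the following five minimization problems. 1. (Dual adversarial) $\displaystyle\inf_{\tilde\mu}\ \sup_{f}\Big\{\sum_i\int f_i\,d\tilde\mu_i+C(\tilde\mu,\mu)\Big\}$, over measures $\tilde\mu$ on $\mathcal Z$ and Borel maps $f$ from $\mathcal X$ to the simplex of probability vectors on $[K]$. 2. (Generalized barycenter) $\displaystyle\inf\Big\{\lambda(\mathcal X)+\sum_iC(\tilde\mu_i,\mu_i)\;:\;\lambda\ge\tilde\mu_i\ \text{for all } i\Big\}$, over measures $\lambda,\tilde\mu_1,\dots,\tilde\mu_K$ on $\mathcal X$. 3. (Stratified) $\displaystyle\inf\Big\{\sum_{A\in S_K}\Big(\lambda_A(\mathcal X)+\sum_{i\in A}C(\lambda_A,\mu_{i,A})\Big)\;:\;\sum_{A\ni i}\mu_{i,A}=\mu_i\ \text{for all } i\Big\}$,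 over measures $\lambda_A,\mu_{i,A}$ on $\mathcal X$. 4. (Multimarginal) $\displaystyle\inf\Big\{\sum_{A\in S_K}\int(c_A+1)\,d\pi_A\;:\;\sum_{A\ni i}P_{i\#}\pi_A=\mu_i\ \text{for all } i\Big\}$, over measures $\pi_A$ on $\mathcal X^K$. 5. (Single coupling) $\displaystyle\inf\Big\{\int\tilde c\,d\gamma\;:\;\tilde P_{i\#}(r_i\gamma)=\mu_i\ \text{for all } i\Big\}$, over measures $\gamma$ on $(\mathcal X\times[0,1])^K$, where $\tilde P_i(\vec x,\vec r)=x_i$. Then each of these problems is equivalent to the next one: the two have the same optimal value, and every feasible point of either one can be converted into a feasible point of the other with lesser or equal objective. In particular all five optimal values are equal. Moreover: (a) For each $A\in S_K$ there is a Borel map $f_A:\mathcal X^K\to\mathcal X$ with $f_A(\vec x)\in T_A(\vec x)$ for all $\vec x$. If $\{\pi_A\}$ is feasible for problem 4 and $f_A$ are $\pi_A$-measurable maps with $f_A(\vec x)\in T_A(\vec x)$ for all $\vec x$, then $\tilde\lambda_A=f_{A\#}\pi_A$, $\tilde\mu_{i,A}=P_{i\#}\pi_A$ are feasible for problem 3 and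 $$\sum_{A}\Big(\tilde\lambda_A(\mathcal X)+\sum_{i\in A}C(\tilde\lambda_A,\tilde\mu_{i,A})\Big)\le\sum_A\int(c_A+1)\,d\pi_A .$$ (b) Let $\{\lambda_A\},\{\mu_{i,A}\}$ be feasible for problem 3, and for $A\in S_K$ and $i\in A$ let $\gamma_{i,A}$ be a coupling of $\lambda_A$ and $\mu_{i,A}$ attaining $C(\lambda_A,\mu_{i,A})$. Then there are measures $\gamma_A$ on $\mathcal X^K\times\mathcal X$ whose marginal in the variables $(x',x_i)$ is $\gamma_{i,A}$ for every $i\in A$; and for any such $\gamma_A$, the marginals $\tilde\pi_A$ of $\gamma_A$ on $\mathcal X^K$ are feasible for problem 4 and $$\sum_A\int(c_A+1)\,d\tilde\pi_A\le\sum_{A}\Big(\lambda_A(\mathcal X)+\sum_{i\in A}C(\lambda_A,\mu_{i,A})\Big).$$ -/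

import Mathlib

open MeasureTheory
open scoped ENNReal NNReal

noncomputable section

namespace AdvMOT

/-! ### Abstract minimization problems and their equivalence -/

/-- A minimization problem with values in `[0, ∞]`: a set of feasible points and an objective. -/
structure MinProblem (α : Type*) where
  feasible : Set α
  objective : α → ℝ≥0∞

/-- The optimal value (infimum of the objective over the feasible points). -/
def MinProblem.value {α : Type*} (P : MinProblem α) : ℝ≥0∞ :=
  ⨅ p ∈ P.feasible, P.objective p

/-- Every feasible point of `P` can be converted into a feasible point of `Q` with lesser or equal
objective. -/
def MinProblem.ConvertsTo {α β : Type*} (P : MinProblem α) (Q : MinProblem β) : Prop :=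
  ∀ p ∈ P.feasible, ∃ q ∈ Q.feasible, Q.objective q ≤ P.objective p

/-- Two minimization problems are equivalent: they have the same optimal value, and feasible points
of either one can be converted into feasible points of the other with lesser or equal objective. -/
def MinProblem.Equivalent {α β : Type*} (P : MinProblem α) (Q : MinProblem β) : Prop :=
  P.value = Q.value ∧ P.ConvertsTo Q ∧ Q.ConvertsTo P

/-! ### Costs and optimal transport -/

/-- The standing assumption on the cost. The first argument of `c` is the perturbed point `x'`, the
second one is the original data point `x`. -/
structure IsAdmissibleCost {X : Type*} [MetricSpace X] (c : X → X → ℝ≥0∞) : Prop where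
  lsc : LowerSemicontinuous (fun p : X × X => c p.1 p.2)
  diag : ∀ x, c x x = 0
  precompact : ∀ x x' : ℕ → X, Bornology.IsBounded (Set.range x) →
    (⨆ n, c (x' n) (x n)) < ∞ → IsCompact (closure (Set.range fun n => (x' n, x n)))

/-- Couplings of two measures on the same space. -/
def couplings {Y : Type*} [MeasurableSpace Y] (ρ ν : Measure Y) : Set (Measure (Y × Y)) :=
  {π | π.map Prod.fst = ρ ∧ π.map Prod.snd = ν}

/-- The optimal transport cost `C(ρ, ν)`; it is `∞` if there is no coupling of `ρ` and `ν`. -/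
def transportCost {Y : Type*} [MeasurableSpace Y] (c : Y → Y → ℝ≥0∞) (ρ ν : Measure Y) : ℝ≥0∞ :=
  ⨅ π ∈ couplings ρ ν, ∫⁻ p, c p.1 p.2 ∂π

/-- The cost on `X × [K]` that forbids changing the label. -/
def labelCost {X : Type*} {K : ℕ} (c : X → X → ℝ≥0∞) (z' z : X × Fin K) : ℝ≥0∞ :=
  if z'.2 = z.2 then c z'.1 z.1 else ∞

section Problems

variable {X : Type*} [MeasurableSpace X] {K : ℕ}

/-- The measure `μ_i` on `X` given by `μ_i(E) = μ(E × {i})`. -/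
def classPart (μ : Measure (X × Fin K)) (i : Fin K) : Measure X :=
  (μ.restrict (Prod.snd ⁻¹' {i})).map Prod.fst

theorem classPart_apply (μ : Measure (X × Fin K)) (i : Fin K) {E : Set X} (hE : MeasurableSet E) :
    classPart μ i E = μ (E ×ˢ {i}) := by
  rw [classPart, Measure.map_apply measurable_fst hE,
    Measure.restrict_apply (measurable_fst hE)]
  rfl

/-! ### The dual adversarial problem -/

variable (X K) in
/-- Probabilistic classifiers: Borel maps from `X` to the simplex of distributions on `[K]`. -/
def classifiers : Set (X → Fin K → ℝ) :=
  {f | Measurable f ∧ ∀ x, f x ∈ stdSimplex ℝ (Fin K)}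

/-- The classification power `B(f, μ') = ∑ i, ∫ f_i dμ'_i`. -/
def classPower (f : X → Fin K → ℝ) (μ' : Measure (X × Fin K)) : ℝ≥0∞ :=
  ∑ i, ∫⁻ x, ENNReal.ofReal (f x i) ∂(classPart μ' i)

/-- `inf over μ'` of `sup over f` of `B(f, μ') + C(μ, μ')`. -/
def dualAdversarial (c : X → X → ℝ≥0∞) (μ : Measure (X × Fin K)) :
    MinProblem (Measure (X × Fin K)) where
  feasible := {μ' | IsFiniteMeasure μ'}
  objective μ' := ⨆ f ∈ classifiers X K, (classPower f μ' + transportCost (labelCost c) μ' μ)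

/-! ### The generalized barycenter problem -/

/-- `inf over (λ, μ'_1, …, μ'_K)` with `μ'_i ≤ λ` of `λ(X) + ∑ i, C(μ_i, μ'_i)`. -/
def generalizedBarycenter (c : X → X → ℝ≥0∞) (μ : Fin K → Measure X) :
    MinProblem (Measure X × (Fin K → Measure X)) where
  feasible := {p | IsFiniteMeasure p.1 ∧ (∀ i, IsFiniteMeasure (p.2 i)) ∧ ∀ i, p.2 i ≤ p.1}
  objective p := p.1 Set.univ + ∑ i, transportCost c (p.2 i) (μ i)

/-! ### The stratified problem -/

variable (K) in
/-- `S_K`: the nonempty subsets of `[K]`. -/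
abbrev Strata : Type := {A : Finset (Fin K) // A.Nonempty}

/-- `inf over (λ_A, μ_{i,A})` with `∑_{A ∋ i} μ_{i,A} = μ_i` of
`∑_A (λ_A(X) + ∑_{i ∈ A} C(λ_A, μ_{i,A}))`. The measures `μ_{i,A}` with `i ∉ A` play no role. -/
def stratified (c : X → X → ℝ≥0∞) (μ : Fin K → Measure X) :
    MinProblem ((Strata K → Measure X) × (Fin K → Strata K → Measure X)) where
  feasible := {p | (∀ A, IsFiniteMeasure (p.1 A)) ∧ (∀ i A, IsFiniteMeasure (p.2 i A)) ∧
    ∀ i, ∑ A : Strata K with i ∈ A.1, p.2 i A = μ i}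
  objective p := ∑ A : Strata K,
    (p.1 A Set.univ + ∑ i ∈ A.1, transportCost c (p.1 A) (p.2 i A))

/-! ### The multimarginal problem -/

/-- `c_A(x_1, …, x_K) = inf over x'` of `∑_{i ∈ A} c(x', x_i)`. -/
def stratumCost {X : Type*} {K : ℕ} (c : X → X → ℝ≥0∞) (A : Strata K) (x : Fin K → X) : ℝ≥0∞ :=
  ⨅ x', ∑ i ∈ A.1, c x' (x i)

/-- `T_A(x_1, …, x_K) = argmin over x'` of `∑_{i ∈ A} c(x', x_i)`. -/
def barycenterSet {X : Type*} {K : ℕ} (c : X → X → ℝ≥0∞) (A : Strata K) (x : Fin K → X) : Set X :=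
  {y | ∀ y', ∑ i ∈ A.1, c y (x i) ≤ ∑ i ∈ A.1, c y' (x i)}

/-- `inf over (π_A)` with `∑_{A ∋ i} P_{i#} π_A = μ_i` of `∑_A ∫ (c_A + 1) dπ_A`. -/
def multimarginal (c : X → X → ℝ≥0∞) (μ : Fin K → Measure X) :
    MinProblem (Strata K → Measure (Fin K → X)) where
  feasible := {π | (∀ A, IsFiniteMeasure (π A)) ∧
    ∀ i, ∑ A : Strata K with i ∈ A.1, (π A).map (fun x => x i) = μ i}
  objective π := ∑ A : Strata K, ∫⁻ x, (stratumCost c A x + 1) ∂(π A)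

/-! ### The single-coupling problem on `(X × [0,1])^K` -/

/-- The linear program `inf over m : S_K → [0, ∞)` with `∑_{A ∋ i} m_A = r_i` of
`∑_A m_A (c_A(x_1, …, x_K) + 1)`, at the point `((x_1, r_1), …, (x_K, r_K))`. -/
def singleCost {X : Type*} {K : ℕ} (c : X → X → ℝ≥0∞) (p : Fin K → X × unitInterval) : ℝ≥0∞ :=
  ⨅ m ∈ {m : Strata K → ℝ≥0 | ∀ i, ∑ A : Strata K with i ∈ A.1, (m A : ℝ) = ((p i).2 : ℝ)},
    ∑ A : Strata K, (m A : ℝ≥0∞) * (stratumCost c A (fun i => (p i).1) + 1)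

/-- `inf over γ` such that the push-forward of `r_i γ` under `(x, r) ↦ x_i` is `μ_i`, for all `i`,
of the integral of the cost `singleCost` against `γ`. -/
def singleCoupling (c : X → X → ℝ≥0∞) (μ : Fin K → Measure X) :
    MinProblem (Measure (Fin K → X × unitInterval)) where
  feasible := {γ | IsFiniteMeasure γ ∧
    ∀ i, (γ.withDensity (fun p => ENNReal.ofReal ((p i).2 : ℝ))).map (fun p => (p i).1) = μ i}
  objective γ := ∫⁻ p, singleCost c p ∂γ

/-! ### Gluing of transport plans -/

/-- `Γ`, a measure on `X^K × X`, glues the plans `G i`, `i ∈ A`: its marginal in the variables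
`(x', x_i)` is `G i`. -/
def IsGluing (A : Strata K) (G : Fin K → Measure (X × X)) (Γ : Measure ((Fin K → X) × X)) : Prop :=
  ∀ i ∈ A.1, Γ.map (fun p => (p.2, p.1 i)) = G i

end Problems

end AdvMOT

end

namespace AdvMOT

open Filter Topology

/-! ### Measurable selections of closed-valued correspondences -/

section Selection

variable {Ω Y : Type*} [MeasurableSpace Ω] [MetricSpace Y]

/-! Consecutive problems are linked by explicit conversions in both directions; equality of values
is then formal.

Dual and barycenter: for fixed `μ'` the best classifier picks the class of largest density, and its
power is the mass of the least measure dominating all `classPart μ' i`. A plan of finite label cost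
never changes labels, so it splits by class.

Barycenter and stratified: write `μ̃_i = h_i λ` with `h_i ≤ 1`. At each `x'` draw a random set
containing `j` independently with probability `h_j`; stratum `A` receives `λ` times the probability
of `A`. Splitting the `i`-th plan by the law conditioned on containing `i` gives plans with common
first marginal `λ_A` (`exists_stratified_le`). Conversely, strata are summed.

Stratified and multimarginal: plans sharing the marginal `λ_A` are glued along it; conversely `π_A`
is pushed forward by a Borel barycenter map.

Multimarginal and single coupling: `π_A` is placed at `r = 1_A`; conversely a Borel solution `m` of
the linear program splits `γ` into the measures `m_A γ`.

The analytic inputs are existence of optimal plans (tightness and lower semicontinuity) and Borel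
choice of minimizers (`Coercive.exists_measurable_argmin`), used for both the barycenters and the
linear program. -/

theorem measurableSet_infDist_lt {T : Ω → Set Y} (hne : ∀ p, (T p).Nonempty)
    (hT : ∀ F : Set Y, IsClosed F → MeasurableSet {p | (T p ∩ F).Nonempty}) (y : Y) (r : ℝ) :
    MeasurableSet {p | Metric.infDist y (T p) < r} := by
  -- The hypothesis concerns closed sets only, so the open ball is exhausted by closed balls of
  -- radius `r - 1/(n+1)`.
  have : {p | Metric.infDist y (T p) < r} =
      ⋃ n : ℕ, {p | (T p ∩ Metric.closedBall y (r - 1 / ((n : ℝ) + 1))).Nonempty} := by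
    ext p
    simp only [Set.mem_ofPred_eq, Set.mem_iUnion, Metric.infDist_lt_iff (hne p)]
    constructor
    · rintro ⟨t, ht, hd⟩
      obtain ⟨n, hn⟩ := exists_nat_one_div_lt (sub_pos.2 hd)
      exact ⟨n, t, ht, by rw [Metric.mem_closedBall, dist_comm]; linarith⟩
    · rintro ⟨n, t, ht, hd⟩
      refine ⟨t, ht, ?_⟩
      rw [Metric.mem_closedBall, dist_comm] at hd
      have : (0 : ℝ) < 1 / ((n : ℝ) + 1) := by positivity
      linarith
  rw [this]
  exact MeasurableSet.iUnion fun n => hT _ Metric.isClosed_closedBall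

variable [MeasurableSpace Y] [BorelSpace Y]

/-- A measurable approximate selection can be refined to a more precise one nearby. -/
theorem exists_measurable_refinement [TopologicalSpace.SeparableSpace Y] {T : Ω → Set Y}
    (hne : ∀ p, (T p).Nonempty)
    (hT : ∀ F : Set Y, IsClosed F → MeasurableSet {p | (T p ∩ F).Nonempty})
    {f : Ω → Y} (hf : Measurable f) {r s : ℝ} (hr : ∀ p, Metric.infDist (f p) (T p) < r)
    (hs : 0 < s) :
    ∃ g : Ω → Y, Measurable g ∧ (∀ p, Metric.infDist (g p) (T p) < s) ∧
      ∀ p, dist (f p) (g p) < r + s := by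
  classical
  rcases isEmpty_or_nonempty Y with hY | hY
  · exact ⟨f, hf, fun p => (hY.false (f p)).elim, fun p => (hY.false (f p)).elim⟩
  let d := TopologicalSpace.denseSeq Y
  -- The new value is sought in a dense sequence; taking the least admissible index makes the choice
  -- measurable.
  have hex : ∀ p, ∃ n, Metric.infDist (d n) (T p) < s ∧ dist (f p) (d n) < r + s := by
    intro p
    obtain ⟨t, ht, htd⟩ := (Metric.infDist_lt_iff (hne p)).1 (hr p)
    obtain ⟨n, hn⟩ := (TopologicalSpace.denseRange_denseSeq Y).exists_dist_lt t hs
    refine ⟨n, (Metric.infDist_lt_iff (hne p)).2 ⟨t, ht, by rwa [dist_comm]⟩, ?_⟩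
    linarith [dist_triangle (f p) t (d n)]
  refine ⟨fun p => d (Nat.find (hex p)), (measurable_from_top (f := d)).comp
    (measurable_find hex fun n => ?_), fun p => (Nat.find_spec (hex p)).1,
    fun p => (Nat.find_spec (hex p)).2⟩
  exact (measurableSet_infDist_lt hne hT _ _).inter
    (measurableSet_lt (hf.dist measurable_const) measurable_const)

/-- **Kuratowski–Ryll-Nardzewski selection theorem**. -/
theorem exists_measurable_selection [CompleteSpace Y] [TopologicalSpace.SeparableSpace Y]
    {T : Ω → Set Y} (hne : ∀ p, (T p).Nonempty) (hcl : ∀ p, IsClosed (T p))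
    (hT : ∀ F : Set Y, IsClosed F → MeasurableSet {p | (T p ∩ F).Nonempty}) :
    ∃ f : Ω → Y, Measurable f ∧ ∀ p, f p ∈ T p := by
  classical
  rcases isEmpty_or_nonempty Ω with hΩ | ⟨⟨p₀⟩⟩
  · exact ⟨fun p => (hΩ.false p).elim, measurable_of_empty _, fun p => (hΩ.false p).elim⟩
  have : Nonempty Y := ⟨(hne p₀).some⟩
  let d := TopologicalSpace.denseSeq Y
  let S (k : ℕ) : Type _ :=
    {f : Ω → Y // Measurable f ∧ ∀ p, Metric.infDist (f p) (T p) < (1 / 2 : ℝ) ^ k}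
  have step : ∀ k (f : S k), ∃ g : S (k + 1),
      ∀ p, dist (f.1 p) (g.1 p) < (1 / 2 : ℝ) ^ k + (1 / 2 : ℝ) ^ (k + 1) := by
    intro k f
    obtain ⟨g, hg, hg1, hg2⟩ := exists_measurable_refinement hne hT f.2.1 f.2.2
      (s := (1 / 2 : ℝ) ^ (k + 1)) (by positivity)
    exact ⟨⟨g, hg, hg1⟩, hg2⟩
  have start : Nonempty (S 0) := by
    have hex : ∀ p, ∃ n, Metric.infDist (d n) (T p) < 1 := by
      intro p
      obtain ⟨n, hn⟩ := (TopologicalSpace.denseRange_denseSeq Y).exists_dist_lt (hne p).some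
        one_pos
      exact ⟨n, (Metric.infDist_lt_iff (hne p)).2 ⟨_, (hne p).some_mem, by rwa [dist_comm]⟩⟩
    exact ⟨⟨fun p => d (Nat.find (hex p)), (measurable_from_top (f := d)).comp
      (measurable_find hex fun n => measurableSet_infDist_lt hne hT _ _),
      fun p => by simpa using Nat.find_spec (hex p)⟩⟩
  choose next hnext using step
  let F : ∀ k, S k := fun k => Nat.rec start.some (fun k f => next k f) k
  -- The steps are summable, so the iterates converge; their distances to `T p` tend to `0`, and
  -- closedness puts the limit in `T p`.
  have hF : ∀ k p, dist ((F k).1 p) ((F (k + 1)).1 p) ≤ 2 * (1 / 2 : ℝ) ^ k := by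
    intro k p
    have h1 := hnext k (F k) p
    have h2 : (1 / 2 : ℝ) ^ (k + 1) ≤ (1 / 2 : ℝ) ^ k :=
      pow_le_pow_of_le_one (by norm_num) (by norm_num) (Nat.le_succ k)
    have : F (k + 1) = next k (F k) := rfl
    rw [this]
    linarith
  have hlim : ∀ p, ∃ y, Tendsto (fun k => (F k).1 p) atTop (𝓝 y) := fun p =>
    cauchySeq_tendsto_of_complete
      (cauchySeq_of_le_geometric (1 / 2 : ℝ) 2 (by norm_num) fun k => hF k p)
  choose f hf using hlim
  refine ⟨f, measurable_of_tendsto_metrizable (fun k => (F k).2.1) (tendsto_pi_nhds.2 hf),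
    fun p => ?_⟩
  rw [(hcl p).mem_iff_infDist_zero (hne p)]
  have h1 : Tendsto (fun k => Metric.infDist ((F k).1 p) (T p)) atTop
      (𝓝 (Metric.infDist (f p) (T p))) :=
    ((Metric.continuous_infDist_pt _).tendsto _).comp (hf p)
  have h2 : Tendsto (fun k : ℕ => (1 / 2 : ℝ) ^ k) atTop (𝓝 0) :=
    tendsto_pow_atTop_nhds_zero_of_lt_one (by norm_num) (by norm_num)
  exact le_antisymm (le_of_tendsto_of_tendsto' h1 h2 fun k => ((F k).2.2 p).le)
    Metric.infDist_nonneg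

end Selection

/-! ### Parametric minimization of coercive lower semicontinuous functions -/

section Argmin

/-- Bounded sublevels of `Φ` are sequentially precompact, locally uniformly in the parameter. -/
def Coercive {Ω Y : Type*} [TopologicalSpace Ω] [TopologicalSpace Y] (Φ : Ω → Y → ℝ≥0∞) : Prop :=
  ∀ (p : ℕ → Ω) (p₀ : Ω) (y : ℕ → Y) (M : ℝ≥0∞), Tendsto p atTop (𝓝 p₀) → M < ∞ →
    (∀ n, Φ (p n) (y n) ≤ M) → ∃ y₀, ∃ φ : ℕ → ℕ, StrictMono φ ∧ Tendsto (y ∘ φ) atTop (𝓝 y₀)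

variable {Ω Y : Type*} [TopologicalSpace Ω] [TopologicalSpace Y] {Φ : Ω → Y → ℝ≥0∞}

/-- Near-minimizers subconverge and joint lower semicontinuity passes to the limit. A constant
sequence `p` yields attainment, a convergent one yields lower semicontinuity of the minimal value.
-/
theorem Coercive.exists_le_of_tendsto (hco : Coercive Φ)
    (hΦ : LowerSemicontinuous (Function.uncurry Φ)) {F : Set Y} (hF : IsClosed F)
    {p : ℕ → Ω} {p₀ : Ω} (hp : Tendsto p atTop (𝓝 p₀)) {a : ℝ≥0∞} (ha : a < ∞)
    (h : ∀ n, ⨅ y ∈ F, Φ (p n) y ≤ a) : ∃ y ∈ F, Φ p₀ y ≤ a := by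
  -- The slack is positive because the infimum need not yet be attained, and at most `1`, so `a + 1`
  -- bounds all values.
  have hy : ∀ n : ℕ, ∃ y ∈ F, Φ (p n) y < a + ((n : ℝ≥0∞) + 1)⁻¹ := by
    intro n
    have : ⨅ y ∈ F, Φ (p n) y < a + ((n : ℝ≥0∞) + 1)⁻¹ :=
      (h n).trans_lt (ENNReal.lt_add_right ha.ne (by simp))
    simpa [iInf_lt_iff] using this
  choose y hyF hy using hy
  obtain ⟨y₀, φ, hφ, hlim⟩ := hco p p₀ y (a + 1) hp (by simp [ha]) fun n => (hy n).le.trans (by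
    gcongr
    simp)
  refine ⟨y₀, hF.mem_of_tendsto hlim (Eventually.of_forall fun n => hyF _), ?_⟩
  have hpair : Tendsto (fun n => (p (φ n), y (φ n))) atTop (𝓝 (p₀, y₀)) :=
    (hp.comp hφ.tendsto_atTop).prodMk_nhds hlim
  have hzero : Tendsto (fun n : ℕ => a + ((φ n : ℝ≥0∞) + 1)⁻¹) atTop (𝓝 (a + 0)) := by
    refine Tendsto.add tendsto_const_nhds ?_
    have h0 : Tendsto (fun n : ℕ => ((n : ℝ≥0∞) + 1)⁻¹) atTop (𝓝 0) := by
      have := (tendsto_add_atTop_iff_nat 1).2 ENNReal.tendsto_inv_nat_nhds_zero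
      simpa using this
    exact h0.comp hφ.tendsto_atTop
  rw [add_zero] at hzero
  refine le_of_forall_lt fun b hb => ?_
  obtain ⟨b', hbb', hb'⟩ := exists_between hb
  have h1 := hpair.eventually (hΦ (p₀, y₀) b' hb')
  refine hbb'.trans_le (ge_of_tendsto hzero ?_)
  filter_upwards [h1] with n hn
  exact hn.le.trans (hy _).le

theorem Coercive.exists_le_iInf (hco : Coercive Φ) (hΦ : LowerSemicontinuous (Function.uncurry Φ))
    {F : Set Y} (hF : IsClosed F) (hne : F.Nonempty) (p : Ω) :
    ∃ y ∈ F, Φ p y ≤ ⨅ y ∈ F, Φ p y := by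
  rcases eq_or_ne (⨅ y ∈ F, Φ p y) ∞ with h | h
  · obtain ⟨y, hy⟩ := hne
    exact ⟨y, hy, h ▸ le_top⟩
  · exact hco.exists_le_of_tendsto hΦ hF tendsto_const_nhds (lt_top_iff_ne_top.2 h)
      fun _ : ℕ => le_rfl

theorem Coercive.lowerSemicontinuous_iInf [FirstCountableTopology Ω] (hco : Coercive Φ)
    (hΦ : LowerSemicontinuous (Function.uncurry Φ)) {F : Set Y} (hF : IsClosed F) :
    LowerSemicontinuous fun p => ⨅ y ∈ F, Φ p y := by
  rw [lowerSemicontinuous_iff_isClosed_preimage]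
  intro a
  rcases eq_or_ne a ∞ with rfl | ha
  · simp
  refine IsSeqClosed.isClosed fun p p₀ hp hlim => ?_
  obtain ⟨y, hyF, hy⟩ := hco.exists_le_of_tendsto hΦ hF hlim (lt_top_iff_ne_top.2 ha) hp
  exact (iInf₂_le (f := fun y (_ : y ∈ F) => Φ p₀ y) y hyF).trans hy

/-- Minimizers of a coercive lower semicontinuous function can be selected in a Borel way. -/
theorem Coercive.exists_measurable_argmin {Ω Y : Type*} [TopologicalSpace Ω]
    [FirstCountableTopology Ω] [MeasurableSpace Ω] [BorelSpace Ω] [MetricSpace Y] [CompleteSpace Y]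
    [TopologicalSpace.SeparableSpace Y] [MeasurableSpace Y] [BorelSpace Y] {Φ : Ω → Y → ℝ≥0∞}
    (hco : Coercive Φ) (hΦ : LowerSemicontinuous (Function.uncurry Φ)) (hY : Ω → Nonempty Y) :
    ∃ f : Ω → Y, Measurable f ∧ ∀ p y, Φ p (f p) ≤ Φ p y := by
  have hclosed : ∀ p, IsClosed {y | ∀ y', Φ p y ≤ Φ p y'} := by
    intro p
    simp only [Set.ofPred_forall]
    refine isClosed_iInter fun y' => ?_
    exact (lowerSemicontinuous_iff_isClosed_preimage.1
      (hΦ.comp (by fun_prop : Continuous fun y => (p, y))) (Φ p y'))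
  refine exists_measurable_selection (T := fun p => {y | ∀ y', Φ p y ≤ Φ p y'}) (fun p => ?_)
    hclosed fun F hF => ?_
  · obtain ⟨y, -, hy⟩ := hco.exists_le_iInf hΦ isClosed_univ
      ((hY p).elim fun y => ⟨y, Set.mem_univ y⟩) p
    exact ⟨y, fun y' => hy.trans (iInf₂_le y' (Set.mem_univ _))⟩
  -- The infimum over the empty set is `∞`, which would satisfy the comparison below wherever the
  -- global infimum is `∞`.
  · rcases F.eq_empty_or_nonempty with rfl | hne
    · simp
    -- `F` meets the argmin exactly when minimizing over `F` loses nothing; this compares two lower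
    -- semicontinuous functions of `p`.
    have : {p | ({y | ∀ y', Φ p y ≤ Φ p y'} ∩ F).Nonempty} =
        {p | ⨅ y ∈ F, Φ p y ≤ ⨅ y ∈ Set.univ, Φ p y} := by
      ext p
      simp only [Set.mem_ofPred_eq]
      constructor
      · rintro ⟨y, hy, hyF⟩
        exact (iInf₂_le y hyF).trans (le_iInf₂ fun y' _ => hy y')
      · intro h
        obtain ⟨y, hyF, hy⟩ := hco.exists_le_iInf hΦ hF hne p
        exact ⟨y, fun y' => (hy.trans h).trans (iInf₂_le y' (Set.mem_univ _)), hyF⟩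
    rw [this]
    exact measurableSet_le (hco.lowerSemicontinuous_iInf hΦ hF).measurable
      (hco.lowerSemicontinuous_iInf hΦ isClosed_univ).measurable

/-- With `0 * ∞ = 0`, a product is the supremum of products of strictly smaller factors, so no
finiteness is needed. This serves `m_A (c_A + 1)`, where `c_A` may be infinite. -/
theorem lowerSemicontinuous_mul {Z : Type*} [TopologicalSpace Z] {f g : Z → ℝ≥0∞}
    (hf : LowerSemicontinuous f) (hg : LowerSemicontinuous g) :
    LowerSemicontinuous fun z => f z * g z := by
  intro z b hb
  have : ∃ a' < f z, ∃ b' < g z, b < a' * b' := by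
    by_contra! h
    exact absurd (ENNReal.mul_le_of_forall_lt h) (not_le.2 hb)
  obtain ⟨a', ha', b', hb', hlt⟩ := this
  filter_upwards [hf z a' ha', hg z b' hb'] with w hw1 hw2
  exact hlt.trans_le (mul_le_mul' hw1.le hw2.le)

end Argmin

/-! ### Optimal transport -/

/-- Layer cake formula for `[0, ∞]`-valued functions. -/
theorem lintegral_eq_lintegral_measure_lt {Z : Type*} [MeasurableSpace Z] (P : Measure Z)
    [SFinite P] {f : Z → ℝ≥0∞} (hf : Measurable f) :
    ∫⁻ z, f z ∂P = ∫⁻ t in Set.Ioi (0 : ℝ), P {z | ENNReal.ofReal t < f z} := by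
  have hS : MeasurableSet {q : Z × ℝ | ENNReal.ofReal q.2 < f q.1} :=
    measurableSet_lt (ENNReal.measurable_ofReal.comp measurable_snd) (hf.comp measurable_fst)
  have h1 := Measure.prod_apply (μ := P) (ν := volume.restrict (Set.Ioi (0 : ℝ))) hS
  rw [Measure.prod_apply_symm hS] at h1
  refine Eq.trans (lintegral_congr fun z => ?_) h1.symm
  rw [Measure.restrict_apply (measurable_prodMk_left hS)]
  rcases eq_or_ne (f z) ∞ with h | h
  · have : Prod.mk z ⁻¹' {q : Z × ℝ | ENNReal.ofReal q.2 < f q.1} ∩ Set.Ioi 0 = Set.Ioi 0 := by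
      ext t; simp [h]
    rw [this, h, Real.volume_Ioi]
  · have : Prod.mk z ⁻¹' {q : Z × ℝ | ENNReal.ofReal q.2 < f q.1} ∩ Set.Ioi 0 =
        Set.Ioo 0 (f z).toReal := by
      ext t
      simp only [Set.mem_inter_iff, Set.mem_preimage, Set.mem_ofPred_eq, Set.mem_Ioi, Set.mem_Ioo]
      constructor
      · rintro ⟨h1, h2⟩
        exact ⟨h2, (ENNReal.ofReal_lt_iff_lt_toReal h2.le h).1 h1⟩
      · rintro ⟨h1, h2⟩
        exact ⟨(ENNReal.ofReal_lt_iff_lt_toReal h1.le h).2 h2, h1⟩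
    rw [this, Real.volume_Ioo, sub_zero, ENNReal.ofReal_toReal h]

/-- Weak lower semicontinuity of the integral of a lower semicontinuous function. -/
theorem lintegral_le_liminf_of_tendsto {Z : Type*} [MeasurableSpace Z] [TopologicalSpace Z]
    [BorelSpace Z] [HasOuterApproxClosed Z] {P : ProbabilityMeasure Z}
    {Ps : ℕ → ProbabilityMeasure Z} (h : Tendsto Ps atTop (𝓝 P)) {f : Z → ℝ≥0∞}
    (hf : LowerSemicontinuous f) :
    ∫⁻ z, f z ∂(P : Measure Z) ≤ liminf (fun n => ∫⁻ z, f z ∂(Ps n : Measure Z)) atTop := by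
  simp_rw [lintegral_eq_lintegral_measure_lt _ hf.measurable]
  -- Superlevel sets are open: the portmanteau inequality applies level by level, and Fatou
  -- integrates it over the levels.
  calc ∫⁻ t in Set.Ioi (0 : ℝ), (P : Measure Z) {z | ENNReal.ofReal t < f z}
      ≤ ∫⁻ t in Set.Ioi (0 : ℝ),
          liminf (fun n => (Ps n : Measure Z) {z | ENNReal.ofReal t < f z}) atTop :=
        lintegral_mono fun t =>
          ProbabilityMeasure.le_liminf_measure_open_of_tendsto h (hf.isOpen_preimage _)
    _ ≤ _ := lintegral_liminf_le fun n => Antitone.measurable fun s t hst =>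
        measure_mono fun z hz => (ENNReal.ofReal_le_ofReal hst).trans_lt hz

section Couplings

variable {Y : Type*} [MeasurableSpace Y]

theorem coupling_univ_left {ρ ν : Measure Y} {π : Measure (Y × Y)} (h : π ∈ couplings ρ ν) :
    π Set.univ = ρ Set.univ := by
  rw [← h.1, Measure.map_apply measurable_fst MeasurableSet.univ, Set.preimage_univ]

theorem isFiniteMeasure_coupling {ρ ν : Measure Y} [IsFiniteMeasure ρ] {π : Measure (Y × Y)}
    (h : π ∈ couplings ρ ν) : IsFiniteMeasure π :=
  ⟨by rw [coupling_univ_left h]; exact measure_lt_top _ _⟩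

theorem smul_mem_couplings {ρ ν : Measure Y} {π : Measure (Y × Y)} (h : π ∈ couplings ρ ν)
    (a : ℝ≥0∞) : a • π ∈ couplings (a • ρ) (a • ν) :=
  ⟨by rw [Measure.map_smul, h.1], by rw [Measure.map_smul, h.2]⟩

/-- The probability measures with prescribed marginals on a Polish space form a compact set. -/
theorem isCompact_couplings [MetricSpace Y] [CompleteSpace Y] [SecondCountableTopology Y]
    [BorelSpace Y] (ρ ν : Measure Y) [IsFiniteMeasure ρ] [IsFiniteMeasure ν] :
    IsCompact {P : ProbabilityMeasure (Y × Y) | (P : Measure (Y × Y)) ∈ couplings ρ ν} := by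
  set S := {P : ProbabilityMeasure (Y × Y) | (P : Measure (Y × Y)) ∈ couplings ρ ν} with hS
  have hclosed : IsClosed S := by
    refine IsSeqClosed.isClosed fun P P₀ hP hlim => ?_
    have key : ∀ (g : Y × Y → Y) (hg : Continuous g) (σ : Measure Y),
        (∀ n, (P n : Measure (Y × Y)).map g = σ) → (P₀ : Measure (Y × Y)).map g = σ := by
      intro g hg σ hσ
      have h1 := (ProbabilityMeasure.continuous_map hg).continuousAt.tendsto.comp hlim
      have h2 : ∀ n, (P n).map hg.measurable.aemeasurable =
          (P 0).map hg.measurable.aemeasurable := by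
        intro n
        apply Subtype.ext
        change (P n : Measure (Y × Y)).map g = (P 0 : Measure (Y × Y)).map g
        rw [hσ, hσ]
      have h3 := tendsto_nhds_unique h1 (tendsto_const_nhds.congr fun n => (h2 n).symm)
      have h4 := congrArg (fun Q : ProbabilityMeasure Y => (Q : Measure Y)) h3
      change (P₀ : Measure (Y × Y)).map g = (P 0 : Measure (Y × Y)).map g at h4
      rw [h4, hσ]
    exact ⟨key _ continuous_fst _ fun n => (hP n).1, key _ continuous_snd _ fun n => (hP n).2⟩
  rw [← hclosed.closure_eq]
  refine isCompact_closure_of_isTightMeasureSet ?_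
  rw [isTightMeasureSet_iff_exists_isCompact_measure_compl_le]
  intro ε hε
  -- Tightness of each marginal, with budget `ε / 2`, controls the whole set of plans through the
  -- product of the two compacts.
  obtain ⟨A, hA, hA'⟩ := isTightMeasureSet_iff_exists_isCompact_measure_compl_le.1
    (isTightMeasureSet_singleton (μ := ρ)) (ε / 2) (ENNReal.half_pos hε.ne')
  obtain ⟨B, hB, hB'⟩ := isTightMeasureSet_iff_exists_isCompact_measure_compl_le.1
    (isTightMeasureSet_singleton (μ := ν)) (ε / 2) (ENNReal.half_pos hε.ne')
  refine ⟨A ×ˢ B, hA.prod hB, ?_⟩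
  rintro _ ⟨P, hP, rfl⟩
  have h1 : (P : Measure (Y × Y)) (Prod.fst ⁻¹' Aᶜ) ≤ ε / 2 := by
    rw [← Measure.map_apply measurable_fst hA.measurableSet.compl, hP.1]
    exact hA' _ rfl
  have h2 : (P : Measure (Y × Y)) (Prod.snd ⁻¹' Bᶜ) ≤ ε / 2 := by
    rw [← Measure.map_apply measurable_snd hB.measurableSet.compl, hP.2]
    exact hB' _ rfl
  calc (P : Measure (Y × Y)) (A ×ˢ B)ᶜ
      ≤ (P : Measure (Y × Y)) (Prod.fst ⁻¹' Aᶜ ∪ Prod.snd ⁻¹' Bᶜ) := by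
        refine measure_mono fun q hq => ?_
        simp only [Set.mem_compl_iff, Set.mem_prod, not_and_or] at hq
        exact hq
    _ ≤ ε / 2 + ε / 2 := (measure_union_le _ _).trans (add_le_add h1 h2)
    _ = ε := ENNReal.add_halves ε

/-- Optimal transport plans exist whenever the transport cost is finite. -/
theorem exists_optimal_coupling [MetricSpace Y] [CompleteSpace Y] [SecondCountableTopology Y]
    [BorelSpace Y] {c : Y → Y → ℝ≥0∞} (hc : LowerSemicontinuous fun q : Y × Y => c q.1 q.2)
    (ρ ν : Measure Y) [IsFiniteMeasure ρ] (h : transportCost c ρ ν ≠ ∞) :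
    ∃ π ∈ couplings ρ ν, ∫⁻ q, c q.1 q.2 ∂π = transportCost c ρ ν := by
  suffices ∃ π ∈ couplings ρ ν, ∫⁻ q, c q.1 q.2 ∂π ≤ transportCost c ρ ν by
    obtain ⟨π, hπ, hle⟩ := this
    exact ⟨π, hπ, hle.antisymm (iInf₂_le π hπ)⟩
  have hex : ∀ n : ℕ, ∃ π ∈ couplings ρ ν,
      ∫⁻ q, c q.1 q.2 ∂π < transportCost c ρ ν + ((n : ℝ≥0∞) + 1)⁻¹ := by
    intro n
    have : transportCost c ρ ν < transportCost c ρ ν + ((n : ℝ≥0∞) + 1)⁻¹ :=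
      ENNReal.lt_add_right h (by simp)
    simpa [transportCost, iInf_lt_iff] using this
  choose π hπ hπc using hex
  rcases eq_or_ne (ρ Set.univ) 0 with h0 | h0
  · refine ⟨π 0, hπ 0, ?_⟩
    rw [← coupling_univ_left (hπ 0), Measure.measure_univ_eq_zero] at h0
    simp [h0]
  -- The compactness result concerns probability measures, so plans are divided by their mass `m`
  -- and the limit is multiplied back.
  set m := ρ Set.univ with hm
  have hmt : m ≠ ∞ := measure_ne_top _ _
  have hmm : m * m⁻¹ = 1 := ENNReal.mul_inv_cancel h0 hmt
  have hν : IsFiniteMeasure ν := by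
    have := isFiniteMeasure_coupling (hπ 0)
    rw [← (hπ 0).2]
    infer_instance
  have : IsFiniteMeasure (m⁻¹ • ρ) := Measure.smul_finite _ (ENNReal.inv_ne_top.2 h0)
  have : IsFiniteMeasure (m⁻¹ • ν) := Measure.smul_finite _ (ENNReal.inv_ne_top.2 h0)
  let P : ℕ → ProbabilityMeasure (Y × Y) := fun n => ⟨m⁻¹ • π n, ⟨by
    rw [Measure.smul_apply, coupling_univ_left (hπ n), smul_eq_mul, mul_comm, hmm]⟩⟩
  obtain ⟨P₀, hP₀, φ, hφ, hlim⟩ := (isCompact_couplings (m⁻¹ • ρ) (m⁻¹ • ν)).tendsto_subseq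
    (x := P) fun n => smul_mem_couplings (hπ n) _
  refine ⟨m • (P₀ : Measure (Y × Y)), ?_, ?_⟩
  · have := smul_mem_couplings hP₀ m
    rwa [smul_smul, smul_smul, hmm, one_smul, one_smul] at this
  have h1 := lintegral_le_liminf_of_tendsto hlim hc
  have h2 : ∀ n, ∫⁻ q, c q.1 q.2 ∂((P ∘ φ) n : Measure (Y × Y)) ≤
      m⁻¹ * (transportCost c ρ ν + ((φ n : ℝ≥0∞) + 1)⁻¹) := by
    intro n
    change ∫⁻ q, c q.1 q.2 ∂(m⁻¹ • π (φ n)) ≤ _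
    rw [lintegral_smul_measure, smul_eq_mul]
    gcongr
    exact (hπc _).le
  have h3 : Tendsto (fun n : ℕ => m⁻¹ * (transportCost c ρ ν + ((φ n : ℝ≥0∞) + 1)⁻¹)) atTop
      (𝓝 (m⁻¹ * (transportCost c ρ ν + 0))) := by
    refine ENNReal.Tendsto.const_mul (Tendsto.add tendsto_const_nhds ?_)
      (Or.inr (ENNReal.inv_ne_top.2 h0))
    have h0 : Tendsto (fun n : ℕ => ((n : ℝ≥0∞) + 1)⁻¹) atTop (𝓝 0) := by
      have := (tendsto_add_atTop_iff_nat 1).2 ENNReal.tendsto_inv_nat_nhds_zero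
      simpa using this
    exact h0.comp hφ.tendsto_atTop
  have h4 : ∫⁻ q, c q.1 q.2 ∂(P₀ : Measure (Y × Y)) ≤ m⁻¹ * transportCost c ρ ν := by
    rw [add_zero] at h3
    exact (h1.trans (liminf_le_liminf (Eventually.of_forall h2))).trans h3.liminf_eq.le
  rw [lintegral_smul_measure, smul_eq_mul]
  calc m * ∫⁻ q, c q.1 q.2 ∂(P₀ : Measure (Y × Y)) ≤ m * (m⁻¹ * transportCost c ρ ν) := by gcongr
    _ = transportCost c ρ ν := by rw [← mul_assoc, hmm, one_mul]

theorem transportCost_le {c : Y → Y → ℝ≥0∞} {ρ ν : Measure Y} {π : Measure (Y × Y)}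
    (h : π ∈ couplings ρ ν) : transportCost c ρ ν ≤ ∫⁻ q, c q.1 q.2 ∂π :=
  iInf₂_le π h

theorem transportCost_zero (c : Y → Y → ℝ≥0∞) : transportCost c 0 0 = 0 :=
  le_antisymm ((transportCost_le (π := 0) ⟨by simp, by simp⟩).trans (by simp)) zero_le

/-- A sum of plans is a plan for the sums; hence merging strata or classes does not raise the cost.
-/
theorem transportCost_add_le (c : Y → Y → ℝ≥0∞) (ρ ρ' ν ν' : Measure Y) :
    transportCost c (ρ + ρ') (ν + ν') ≤ transportCost c ρ ν + transportCost c ρ' ν' := by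
  simp only [transportCost, ENNReal.iInf_add, ENNReal.add_iInf]
  refine le_iInf₂ fun π hπ => le_iInf₂ fun π' hπ' => ?_
  refine (iInf₂_le (π' + π) ⟨?_, ?_⟩).trans (lintegral_add_measure _ _ _).le
  · rw [Measure.map_add _ _ measurable_fst, hπ.1, hπ'.1]
  · rw [Measure.map_add _ _ measurable_snd, hπ.2, hπ'.2]

theorem transportCost_sum_le {ι : Type*} (c : Y → Y → ℝ≥0∞) (s : Finset ι) (ρ ν : ι → Measure Y) :
    transportCost c (∑ a ∈ s, ρ a) (∑ a ∈ s, ν a) ≤ ∑ a ∈ s, transportCost c (ρ a) (ν a) := by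
  classical
  induction s using Finset.induction_on with
  | empty => simp [transportCost_zero]
  | insert a s ha ih =>
    rw [Finset.sum_insert ha, Finset.sum_insert ha, Finset.sum_insert ha]
    exact (transportCost_add_le _ _ _ _ _).trans (by gcongr)

theorem transportCost_map_le {Z : Type*} [MeasurableSpace Z] (d : Z → Z → ℝ≥0∞) {g : Y → Z}
    (hg : Measurable g) (ρ ν : Measure Y) :
    transportCost d (ρ.map g) (ν.map g) ≤ transportCost (fun y' y => d (g y') (g y)) ρ ν := by
  refine le_iInf₂ fun π hπ => ?_
  refine (transportCost_le (π := π.map (Prod.map g g)) ⟨?_, ?_⟩).trans (lintegral_map_le _ _)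
  · rw [Measure.map_map measurable_fst (hg.prodMap hg), ← hπ.1, Measure.map_map hg measurable_fst]
    rfl
  · rw [Measure.map_map measurable_snd (hg.prodMap hg), ← hπ.2, Measure.map_map hg measurable_snd]
    rfl

end Couplings

/-! ### Gluing -/

/-- The product of finitely many Markov kernels with the same source. -/
noncomputable def piKernel {Ω ι Y : Type*} [Fintype ι] [MeasurableSpace Ω] [MeasurableSpace Y]
    (κ : ι → ProbabilityTheory.Kernel Ω Y) [∀ i, ProbabilityTheory.IsMarkovKernel (κ i)] :
    ProbabilityTheory.Kernel Ω (ι → Y) where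
  toFun x := Measure.pi fun i => κ i x
  measurable' := by
    refine Measurable.measure_of_isPiSystem_of_isProbabilityMeasure generateFrom_pi.symm
      isPiSystem_pi ?_
    rintro _ ⟨s, hs, rfl⟩
    simp only [Measure.pi_pi]
    exact Finset.measurable_prod _ fun i _ =>
      ProbabilityTheory.Kernel.measurable_coe (κ i) (hs i (Set.mem_univ i))

section Gluing

open scoped ProbabilityTheory

variable {Ω ι Y : Type*} [Fintype ι] [MeasurableSpace Ω] [MeasurableSpace Y]
  (κ : ι → ProbabilityTheory.Kernel Ω Y) [∀ i, ProbabilityTheory.IsMarkovKernel (κ i)]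

instance isMarkovKernel_piKernel : ProbabilityTheory.IsMarkovKernel (piKernel κ) :=
  ⟨fun x => inferInstanceAs (IsProbabilityMeasure (Measure.pi fun i => κ i x))⟩

theorem piKernel_map_eval (i : ι) : (piKernel κ).map (fun y : ι → Y => y i) = κ i := by
  ext1 x
  rw [ProbabilityTheory.Kernel.map_apply _ (measurable_pi_apply i)]
  exact (measurePreserving_eval (fun j => κ j x) i).map_eq

/-- Finitely many plans with the same first marginal can be glued along it. -/
theorem exists_gluing {ι X Y : Type*} [Fintype ι] [MeasurableSpace X] [MeasurableSpace Y]
    [StandardBorelSpace Y] [Nonempty Y] (s : Finset ι) (G : ι → Measure (X × Y)) (ρ : Measure X)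
    [IsFiniteMeasure ρ] (hG : ∀ i ∈ s, (G i).map Prod.fst = ρ) :
    ∃ Γ : Measure ((ι → Y) × X), ∀ i ∈ s, Γ.map (fun p => (p.2, p.1 i)) = G i := by
  classical
  have hfin : ∀ i ∈ s, IsFiniteMeasure (G i) := by
    intro i hi
    refine ⟨?_⟩
    have := measure_lt_top ρ Set.univ
    rwa [← hG i hi, Measure.map_apply measurable_fst MeasurableSet.univ, Set.preimage_univ] at this
  -- Indices outside `s` receive an arbitrary constant kernel, so that the product runs over all of
  -- `ι`.
  have hex : ∀ i, ∃ κ : ProbabilityTheory.Kernel X Y, ProbabilityTheory.IsMarkovKernel κ ∧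
      (i ∈ s → ρ ⊗ₘ κ = G i) := by
    intro i
    by_cases hi : i ∈ s
    · have := hfin i hi
      refine ⟨(G i).condKernel, inferInstance, fun _ => ?_⟩
      rw [← hG i hi]
      exact (G i).disintegrate (G i).condKernel
    · exact ⟨ProbabilityTheory.Kernel.const X (Measure.dirac (Classical.arbitrary Y)),
        inferInstance, fun h => (hi h).elim⟩
  choose κ hκ hκG using hex
  -- Given `x'`, the coordinates are made independent, each with its own conditional law.
  refine ⟨(ρ ⊗ₘ piKernel κ).map Prod.swap, fun i hi => ?_⟩
  rw [Measure.map_map (by fun_prop) measurable_swap, ← hκG i hi, ← piKernel_map_eval κ i,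
    Measure.compProd_map (measurable_pi_apply i)]
  rfl

end Gluing

/-! ### From conversions to equivalence -/

theorem MinProblem.ConvertsTo.value_le {α β : Type*} {P : MinProblem α} {Q : MinProblem β}
    (h : P.ConvertsTo Q) : Q.value ≤ P.value :=
  le_iInf₂ fun p hp => by
    obtain ⟨q, hq, hle⟩ := h p hp
    exact (iInf₂_le q hq).trans hle

theorem MinProblem.ConvertsTo.equivalent {α β : Type*} {P : MinProblem α} {Q : MinProblem β}
    (h : P.ConvertsTo Q) (h' : Q.ConvertsTo P) : P.Equivalent Q :=
  ⟨h'.value_le.antisymm h.value_le, h, h'⟩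

/-! ### The dual adversarial problem and the generalized barycenter problem -/

section Labels

variable {X : Type*} [MeasurableSpace X] {K : ℕ}

theorem isFiniteMeasure_classPart (μ : Measure (X × Fin K)) [IsFiniteMeasure μ] (i : Fin K) :
    IsFiniteMeasure (classPart μ i) := by
  unfold classPart
  infer_instance

theorem classPart_sum_map (ρ : Fin K → Measure X) (j : Fin K) :
    classPart (∑ i, (ρ i).map (fun x => (x, i))) j = ρ j := by
  ext E hE
  rw [classPart_apply _ _ hE, Measure.finsetSum_apply, Finset.sum_eq_single j]
  · rw [Measure.map_apply measurable_prodMk_right (hE.prod (measurableSet_singleton j))]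
    congr 1
    ext x
    simp
  · intro i _ hij
    rw [Measure.map_apply measurable_prodMk_right (hE.prod (measurableSet_singleton j))]
    convert measure_empty (μ := ρ i)
    ext x
    simp [hij]
  · simp

theorem sum_map_classPart (μ : Measure (X × Fin K)) :
    ∑ i, (classPart μ i).map (fun x => (x, i)) = μ := by
  ext E hE
  rw [Measure.finsetSum_apply]
  have h := sum_measure_preimage_singleton (μ := μ.restrict E) (Finset.univ : Finset (Fin K))
    (f := Prod.snd) fun i _ => measurable_snd (measurableSet_singleton i)
  simp only [Finset.coe_univ, Set.preimage_univ, Measure.restrict_apply_univ] at h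
  rw [← h]
  refine Finset.sum_congr rfl fun i _ => ?_
  rw [Measure.map_apply measurable_prodMk_right hE,
    classPart_apply _ _ (measurable_prodMk_right hE),
    Measure.restrict_apply (measurable_snd (measurableSet_singleton i))]
  congr 1
  ext ⟨x, j⟩
  simp only [Set.mem_prod, Set.mem_preimage, Set.mem_singleton_iff, Set.mem_inter_iff]
  constructor
  · rintro ⟨h, rfl⟩
    exact ⟨rfl, h⟩
  · rintro ⟨rfl, h⟩
    exact ⟨h, rfl⟩

theorem transportCost_labelCost_le (c : X → X → ℝ≥0∞) (μ' μ : Measure (X × Fin K)) :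
    transportCost (labelCost c) μ' μ ≤ ∑ i, transportCost c (classPart μ' i) (classPart μ i) := by
  conv_lhs => rw [← sum_map_classPart μ', ← sum_map_classPart μ]
  refine (transportCost_sum_le _ _ _ _).trans (Finset.sum_le_sum fun i _ => ?_)
  refine (transportCost_map_le _ measurable_prodMk_right _ _).trans (le_of_eq ?_)
  simp [labelCost]

/-- A plan of finite cost charges only pairs with equal labels, so its restrictions to the blocks `B
i` are plans between the class parts. -/
theorem sum_transportCost_classPart_le {c : X → X → ℝ≥0∞}
    (hc : Measurable fun q : X × X => c q.1 q.2) (μ' μ : Measure (X × Fin K)) :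
    ∑ i, transportCost c (classPart μ' i) (classPart μ i) ≤ transportCost (labelCost c) μ' μ := by
  refine le_iInf₂ fun π hπ => ?_
  rcases eq_or_ne (∫⁻ q, labelCost c q.1 q.2 ∂π) ∞ with htop | hfin
  · rw [htop]
    exact le_top
  have hmeas : Measurable fun q : (X × Fin K) × (X × Fin K) => labelCost c q.1 q.2 :=
    Measurable.ite (measurableSet_eq_fun (by fun_prop) (by fun_prop))
      (hc.comp (by fun_prop : Measurable fun q : (X × Fin K) × (X × Fin K) => (q.1.1, q.2.1)))
      measurable_const
  have hae : ∀ᵐ q ∂π, q.1.2 = q.2.2 := by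
    filter_upwards [ae_lt_top hmeas hfin] with q hq
    by_contra hne
    simp [labelCost, hne] at hq
  let B : Fin K → Set ((X × Fin K) × (X × Fin K)) := fun i => {q | q.1.2 = i ∧ q.2.2 = i}
  have hB : ∀ i, MeasurableSet (B i) := fun i =>
    (measurableSet_eq_fun (by fun_prop) measurable_const).inter
      (measurableSet_eq_fun (by fun_prop) measurable_const)
  have hpair : Measurable fun q : (X × Fin K) × (X × Fin K) => (q.1.1, q.2.1) := by fun_prop
  have hcoup : ∀ i, (π.restrict (B i)).map (fun q => (q.1.1, q.2.1)) ∈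
      couplings (classPart μ' i) (classPart μ i) := by
    intro i
    have hS : MeasurableSet (Prod.snd ⁻¹' {i} : Set (X × Fin K)) :=
      measurable_snd (measurableSet_singleton i)
    constructor
    · rw [classPart, ← hπ.1, Measure.restrict_map measurable_fst hS,
        Measure.map_map measurable_fst measurable_fst, Measure.map_map measurable_fst hpair]
      -- Up to a null set, the label of one endpoint already determines the block.
      have : π.restrict (Prod.fst ⁻¹' (Prod.snd ⁻¹' {i})) = π.restrict (B i) := by
        refine Measure.restrict_congr_set ?_
        filter_upwards [hae] with q hq
        exact propext ⟨fun h => ⟨h, hq.symm.trans h⟩, fun h => h.1⟩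
      rw [this]
      rfl
    · rw [classPart, ← hπ.2, Measure.restrict_map measurable_snd hS,
        Measure.map_map measurable_fst measurable_snd, Measure.map_map measurable_snd hpair]
      have : π.restrict (Prod.snd ⁻¹' (Prod.snd ⁻¹' {i})) = π.restrict (B i) := by
        refine Measure.restrict_congr_set ?_
        filter_upwards [hae] with q hq
        exact propext ⟨fun h => ⟨hq.trans h, h⟩, fun h => h.2⟩
      rw [this]
      rfl
  have hdisj : Pairwise (Function.onFun Disjoint B) := fun i j hij =>
    Set.disjoint_left.2 fun q hi hj => hij (hi.1.symm.trans hj.1)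
  calc ∑ i, transportCost c (classPart μ' i) (classPart μ i)
      ≤ ∑ i, ∫⁻ q in B i, labelCost c q.1 q.2 ∂π := by
        refine Finset.sum_le_sum fun i _ => (transportCost_le (hcoup i)).trans
          ((lintegral_map_le _ _).trans (setLIntegral_mono' (hB i) fun q hq => ?_))
        simp [labelCost, hq.1, hq.2]
    _ = ∫⁻ q in ⋃ i, B i, labelCost c q.1 q.2 ∂π := by
        rw [lintegral_iUnion hB hdisj, tsum_fintype]
    _ ≤ ∫⁻ q, labelCost c q.1 q.2 ∂π := setLIntegral_le_lintegral _ _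

end Labels

/-! ### Optimal classifiers and least upper bounds of measures -/

section Dual

variable {X : Type*} [MeasurableSpace X] {K : ℕ}

/-- Ties are broken by the least maximizing index, searched for as a natural number so that
`measurable_find` applies. -/
theorem exists_measurable_argmax [NeZero K] {g : Fin K → X → ℝ≥0∞} (hg : ∀ i, Measurable (g i)) :
    ∃ idx : X → Fin K, Measurable idx ∧ ∀ x j, g j x ≤ g (idx x) x := by
  classical
  have hex : ∀ x, ∃ n, ∃ h : n < K, ∀ j, g j x ≤ g ⟨n, h⟩ x := by
    intro x
    obtain ⟨i, hi⟩ := Finite.exists_max fun i => g i x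
    exact ⟨i, i.2, hi⟩
  have hfind : Measurable fun x => Nat.find (hex x) := by
    refine measurable_find hex fun n => ?_
    by_cases hn : n < K
    · simp only [hn, exists_true_left]
      simp only [Set.ofPred_forall]
      exact MeasurableSet.iInter fun j => measurableSet_le (hg j) (hg _)
    · simp [hn]
  refine ⟨fun x => ⟨Nat.find (hex x), (Nat.find_spec (hex x)).1⟩,
    measurable_to_countable' fun i => ?_, fun x => (Nat.find_spec (hex x)).2⟩
  convert hfind (measurableSet_singleton (i : ℕ)) using 1
  ext x
  simp [Fin.ext_iff]

/-- The transport term does not depend on `f`; pulling it out of the supremum requires a classifier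
to exist, hence `NeZero K`. -/
theorem dualAdversarial_objective [NeZero K] (c : X → X → ℝ≥0∞) (μ μ' : Measure (X × Fin K)) :
    (dualAdversarial c μ).objective μ' =
      (⨆ f ∈ classifiers X K, classPower f μ') + transportCost (labelCost c) μ' μ := by
  have hne : ∃ f, f ∈ classifiers X K :=
    ⟨fun _ => Pi.single 0 1, measurable_const, fun _ => single_mem_stdSimplex ℝ 0⟩
  exact (ENNReal.biSup_add' hne _).symm

/-- The power of the best classifier is the mass of a common upper bound of the class measures. -/
theorem exists_upperBound_of_classPower [NeZero K] (μ' : Measure (X × Fin K)) [IsFiniteMeasure μ'] :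
    ∃ lam : Measure X, IsFiniteMeasure lam ∧ (∀ i, classPart μ' i ≤ lam) ∧
      ∃ f ∈ classifiers X K, lam Set.univ = classPower f μ' := by
  classical
  have hfin := isFiniteMeasure_classPart μ'
  set ρ := classPart μ' with hρ
  let ν : Measure X := ∑ i, ρ i
  have hle : ∀ i, ρ i ≤ ν := fun i => Measure.le_iff'.2 fun s => by
    rw [Measure.finsetSum_apply]
    exact Finset.single_le_sum (f := fun i => ρ i s) (fun _ _ => zero_le) (Finset.mem_univ i)
  -- The least upper bound of the `ρ i` has density `⨆ i, g i` with respect to their sum `ν`.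
  let g : Fin K → X → ℝ≥0∞ := fun i => (ρ i).rnDeriv ν
  have hg : ∀ i, Measurable (g i) := fun i => Measure.measurable_rnDeriv _ _
  have hν : IsFiniteMeasure ν := inferInstance
  have hdens : ∀ i, ν.withDensity (g i) = ρ i := fun i =>
    Measure.withDensity_rnDeriv_eq _ _ (Measure.absolutelyContinuous_of_le (hle i))
  obtain ⟨idx, hidx, hmax⟩ := exists_measurable_argmax hg
  have hI : ∀ i, MeasurableSet (idx ⁻¹' {i}) := fun i => hidx (measurableSet_singleton i)
  let f : X → Fin K → ℝ := fun x => Pi.single (idx x) 1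
  have hf : f ∈ classifiers X K := by
    refine ⟨measurable_pi_iff.2 fun i => ?_, fun x => single_mem_stdSimplex ℝ (idx x)⟩
    have : (fun x => f x i) = (idx ⁻¹' {i}).indicator fun _ => 1 := by
      ext x
      simp [f, Pi.single_apply, Set.indicator_apply, eq_comm]
    rw [this]
    exact measurable_const.indicator (hI i)
  have hsup : ∀ x, ⨆ i, g i x = ∑ i, (idx ⁻¹' {i}).indicator (g i) x := by
    intro x
    rw [Finset.sum_eq_single (idx x)]
    · rw [Set.indicator_of_mem (by simp)]
      exact le_antisymm (iSup_le (hmax x)) (le_iSup (fun i => g i x) (idx x))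
    · intro i _ hi
      exact Set.indicator_of_notMem (by simpa [eq_comm] using hi) _
    · simp
  have hmass : (ν.withDensity fun x => ⨆ i, g i x) Set.univ = classPower f μ' := by
    rw [withDensity_apply _ MeasurableSet.univ, Measure.restrict_univ]
    simp only [hsup]
    rw [lintegral_finsetSum _ fun i _ => (hg i).indicator (hI i)]
    refine Finset.sum_congr rfl fun i _ => ?_
    rw [lintegral_indicator (hI i), ← withDensity_apply _ (hI i), hdens,
      ← lintegral_indicator_one (hI i)]
    refine lintegral_congr fun x => ?_
    by_cases hx : idx x = i <;> simp [f, hx]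
  refine ⟨ν.withDensity fun x => ⨆ i, g i x, ⟨?_⟩, fun i => ?_, f, hf, hmass⟩
  · rw [hmass]
    refine (ENNReal.sum_lt_top.2 fun i _ => ?_)
    refine lt_of_le_of_lt (lintegral_mono (g := fun _ => 1) fun x => ?_) (by simp)
    by_cases hx : i = idx x <;> simp [f, hx]
  · rw [← hdens i]
    exact withDensity_mono (Eventually.of_forall fun x => le_iSup (fun i => g i x) i)

theorem classPower_le {f : X → Fin K → ℝ} (hf : f ∈ classifiers X K) {μ' : Measure (X × Fin K)}
    {lam : Measure X} (h : ∀ i, classPart μ' i ≤ lam) : classPower f μ' ≤ lam Set.univ := by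
  calc classPower f μ' ≤ ∑ i, ∫⁻ x, ENNReal.ofReal (f x i) ∂lam :=
        Finset.sum_le_sum fun i _ => lintegral_mono' (h i) le_rfl
    _ = ∫⁻ x, ∑ i, ENNReal.ofReal (f x i) ∂lam :=
        (lintegral_finsetSum _ fun i _ =>
          ENNReal.measurable_ofReal.comp (measurable_pi_iff.1 hf.1 i)).symm
    _ = lam Set.univ := by
        rw [← lintegral_one]
        refine lintegral_congr fun x => ?_
        rw [← ENNReal.ofReal_sum_of_nonneg fun i _ => (hf.2 x).1 i, (hf.2 x).2, ENNReal.ofReal_one]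

theorem dualAdversarial_convertsTo [NeZero K] {c : X → X → ℝ≥0∞}
    (hc : Measurable fun q : X × X => c q.1 q.2) (μ : Measure (X × Fin K)) :
    (dualAdversarial c μ).ConvertsTo (generalizedBarycenter c (classPart μ)) := by
  intro μ' hμ'
  have : IsFiniteMeasure μ' := hμ'
  obtain ⟨lam, hlam, hle, f, hf, hmass⟩ := exists_upperBound_of_classPower μ'
  refine ⟨(lam, classPart μ'), ⟨hlam, isFiniteMeasure_classPart μ', hle⟩, ?_⟩
  rw [dualAdversarial_objective]
  refine add_le_add ?_ (sum_transportCost_classPart_le hc μ' μ)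
  exact hmass.trans_le (le_iSup₂ (f := fun f (_ : f ∈ classifiers X K) => classPower f μ') f hf)

theorem generalizedBarycenter_convertsTo_dualAdversarial [NeZero K] (c : X → X → ℝ≥0∞)
    (μ : Measure (X × Fin K)) :
    (generalizedBarycenter c (classPart μ)).ConvertsTo (dualAdversarial c μ) := by
  rintro ⟨lam, ρ⟩ ⟨hlam, hρ, hle⟩
  dsimp only at hlam hρ hle
  refine ⟨∑ i, (ρ i).map (fun x => (x, i)), ?_, ?_⟩
  · change IsFiniteMeasure _
    infer_instance
  rw [dualAdversarial_objective]
  refine add_le_add (iSup₂_le fun f hf => classPower_le hf fun i => ?_) ?_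
  · rw [classPart_sum_map]
    exact hle i
  · refine (transportCost_labelCost_le c _ μ).trans (le_of_eq ?_)
    simp only [classPart_sum_map]

end Dual

/-! ### The generalized barycenter problem and the stratified problem -/

theorem sum_strata_comm {K : ℕ} {M : Type*} [AddCommMonoid M] (F : Fin K → Strata K → M) :
    ∑ A : Strata K, ∑ i ∈ A.1, F i A = ∑ i, ∑ A : Strata K with i ∈ A.1, F i A :=
  Finset.sum_comm' (by simp)

section Weights

variable {K : ℕ}

/-- The probability that a random set, containing each `j` independently with probability `h j`,
equals `A`. -/
noncomputable def setWeight (h : Fin K → ℝ≥0∞) (A : Finset (Fin K)) : ℝ≥0∞ :=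
  (∏ j ∈ A, h j) * ∏ j ∈ Finset.univ \ A, (1 - h j)

/-- The conditional version of `setWeight`, given that the random set contains `i`. -/
noncomputable def condSetWeight (h : Fin K → ℝ≥0∞) (i : Fin K) (A : Finset (Fin K)) : ℝ≥0∞ :=
  (∏ j ∈ A.erase i, h j) * ∏ j ∈ Finset.univ \ A, (1 - h j)

/-- The left side depends on `i` and the right side does not: this gives all plans of one stratum
the same first marginal. -/
theorem mul_condSetWeight (h : Fin K → ℝ≥0∞) {i : Fin K} {A : Finset (Fin K)} (hi : i ∈ A) :
    h i * condSetWeight h i A = setWeight h A := by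
  rw [condSetWeight, setWeight, ← mul_assoc, Finset.mul_prod_erase _ _ hi]

/-- Over all subsets the weights sum to `∏ (h j + (1 - h j)) = 1`; the empty set is not a stratum,
whence only an inequality. -/
theorem sum_setWeight_le {h : Fin K → ℝ≥0∞} (hh : ∀ j, h j ≤ 1) :
    ∑ A : Strata K, setWeight h A.1 ≤ 1 := by
  have h1 := Finset.prod_add h (fun j => 1 - h j) Finset.univ
  simp only [add_tsub_cancel_of_le (hh _), Finset.prod_const_one] at h1
  rw [h1, Finset.powerset_univ]
  refine (Finset.sum_map Finset.univ (Function.Embedding.subtype _) (setWeight h)).symm.trans_le ?_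
  exact Finset.sum_le_sum_of_subset (Finset.subset_univ _)

/-- Erasing `i` turns the sets containing `i` into all subsets of the other indices, where the
product expansion gives exactly `1`. -/
theorem sum_condSetWeight {h : Fin K → ℝ≥0∞} (hh : ∀ j, h j ≤ 1) (i : Fin K) :
    ∑ A : Strata K with i ∈ A.1, condSetWeight h i A.1 = 1 := by
  have h1 := Finset.prod_add h (fun j => 1 - h j) (Finset.univ.erase i)
  simp only [add_tsub_cancel_of_le (hh _), Finset.prod_const_one] at h1
  rw [h1]
  refine Finset.sum_bij' (fun A _ => A.1.erase i)
    (fun t _ => ⟨insert i t, Finset.insert_nonempty i t⟩) ?_ ?_ ?_ ?_ ?_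
  · intro A _
    exact Finset.mem_powerset.2 (Finset.erase_subset_erase i (Finset.subset_univ _))
  · intro t _
    simp
  · intro A hA
    exact Subtype.ext (Finset.insert_erase (Finset.mem_filter.1 hA).2)
  · intro t ht
    exact Finset.erase_insert fun hi => by simpa using Finset.mem_powerset.1 ht hi
  · intro A hA
    rw [condSetWeight]
    congr 2
    have := (Finset.mem_filter.1 hA).2
    ext j
    simp only [Finset.mem_sdiff, Finset.mem_univ, Finset.mem_erase, true_and, and_true]
    grind

theorem condSetWeight_le_one {h : Fin K → ℝ≥0∞} (hh : ∀ j, h j ≤ 1) (i : Fin K)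
    (A : Finset (Fin K)) : condSetWeight h i A ≤ 1 :=
  mul_le_one' (Finset.prod_le_one' fun j _ => hh j)
    (Finset.prod_le_one' fun _ _ => tsub_le_self)

theorem measurable_setWeight {X : Type*} [MeasurableSpace X] {h : Fin K → X → ℝ≥0∞}
    (hh : ∀ j, Measurable (h j)) (A : Finset (Fin K)) :
    Measurable fun x => setWeight (fun j => h j x) A :=
  (Finset.measurable_fun_prod _ fun j _ => hh j).mul
    (Finset.measurable_fun_prod _ fun j _ => measurable_const.sub (hh j))

theorem measurable_condSetWeight {X : Type*} [MeasurableSpace X] {h : Fin K → X → ℝ≥0∞}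
    (hh : ∀ j, Measurable (h j)) (i : Fin K) (A : Finset (Fin K)) :
    Measurable fun x => condSetWeight (fun j => h j x) i A :=
  (Finset.measurable_fun_prod _ fun j _ => hh j).mul
    (Finset.measurable_fun_prod _ fun j _ => measurable_const.sub (hh j))

end Weights

/-! ### Splitting measures by densities -/

section WithDensity

variable {Z W : Type*} [MeasurableSpace Z] [MeasurableSpace W]

theorem sum_withDensity {ι : Type*} (μ : Measure Z) (s : Finset ι) {f : ι → Z → ℝ≥0∞}
    (hf : ∀ a, Measurable (f a)) :
    ∑ a ∈ s, μ.withDensity (f a) = μ.withDensity fun z => ∑ a ∈ s, f a z := by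
  ext E hE
  simp only [Measure.finsetSum_apply, withDensity_apply _ hE]
  exact (lintegral_finsetSum _ fun a _ => hf a).symm

theorem map_withDensity_comp (μ : Measure Z) {g : Z → W} (hg : Measurable g) {f : W → ℝ≥0∞}
    (hf : Measurable f) :
    (μ.withDensity fun z => f (g z)).map g = (μ.map g).withDensity f := by
  ext E hE
  rw [Measure.map_apply hg hE, withDensity_apply _ (hg hE), withDensity_apply _ hE,
    setLIntegral_map hE hf hg]

/-- Measures dominated by a finite measure have densities bounded by `1`. -/
theorem exists_density_le_one {μ ν : Measure Z} [IsFiniteMeasure ν] (h : μ ≤ ν) :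
    ∃ f : Z → ℝ≥0∞, Measurable f ∧ (∀ z, f z ≤ 1) ∧ ν.withDensity f = μ := by
  have : IsFiniteMeasure μ := isFiniteMeasure_of_le ν h
  -- Truncation makes the bound hold everywhere rather than almost everywhere, as the pointwise
  -- weights require.
  refine ⟨fun z => min (μ.rnDeriv ν z) 1, (Measure.measurable_rnDeriv _ _).min measurable_const,
    fun z => min_le_right _ _, ?_⟩
  conv_rhs => rw [← Measure.withDensity_rnDeriv_eq _ _ (Measure.absolutelyContinuous_of_le h)]
  refine withDensity_congr_ae ?_
  filter_upwards [Measure.rnDeriv_le_one_of_le h] with z hz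
  exact min_eq_left hz

theorem isFiniteMeasure_withDensity_le_one (μ : Measure Z) [IsFiniteMeasure μ] {f : Z → ℝ≥0∞}
    (hf : ∀ z, f z ≤ 1) : IsFiniteMeasure (μ.withDensity f) :=
  isFiniteMeasure_of_le μ
    ((withDensity_mono (Eventually.of_forall hf)).trans_eq (by exact withDensity_one))

end WithDensity

/-! ### Conversion between barycenters and strata -/

section Stratified

variable {X : Type*} [MeasurableSpace X] {K : ℕ}

/-- Any feasible point will do when the objective to be beaten is infinite. -/
theorem stratified_feasible_nonempty (c : X → X → ℝ≥0∞) (μ : Fin K → Measure X)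
    [∀ i, IsFiniteMeasure (μ i)] : (stratified c μ).feasible.Nonempty := by
  classical
  refine ⟨(fun _ => 0, fun i A => if A.1 = {i} then μ i else 0), fun _ => inferInstance,
    fun i A => ?_, fun i => ?_⟩
  · dsimp only
    split_ifs <;> infer_instance
  · dsimp only
    rw [Finset.sum_eq_single ⟨{i}, Finset.singleton_nonempty i⟩]
    · simp
    · intro A _ hA
      exact if_neg fun h => hA (Subtype.ext h)
    · simp

/-- A dominated family together with transport plans decomposes into strata. -/
theorem exists_stratified_le (c : X → X → ℝ≥0∞)
    {lam : Measure X} [IsFiniteMeasure lam]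
    {ρ μ : Fin K → Measure X} (hle : ∀ i, ρ i ≤ lam) (π : Fin K → Measure (X × X))
    (hπ : ∀ i, π i ∈ couplings (ρ i) (μ i)) :
    ∃ p ∈ (stratified c μ).feasible, (stratified c μ).objective p ≤
      lam Set.univ + ∑ i, ∫⁻ q, c q.1 q.2 ∂(π i) := by
  choose h hh hh1 hdens using fun i => exists_density_le_one (hle i)
  have hfin : ∀ i, IsFiniteMeasure (π i) := fun i =>
    have := isFiniteMeasure_of_le lam (hle i)
    isFiniteMeasure_coupling (hπ i)
  let w : Strata K → X → ℝ≥0∞ := fun A x => setWeight (fun j => h j x) A.1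
  let v : Fin K → Strata K → X → ℝ≥0∞ := fun i A x => condSetWeight (fun j => h j x) i A.1
  have hw : ∀ A, Measurable (w A) := fun A => measurable_setWeight hh A.1
  have hv : ∀ i A, Measurable (v i A) := fun i A => measurable_condSetWeight hh i A.1
  have hv1 : ∀ i A x, v i A x ≤ 1 := fun i A x => condSetWeight_le_one (fun j => hh1 j x) i A.1
  have hw1 : ∀ x, ∑ A, w A x ≤ 1 := fun x => sum_setWeight_le fun j => hh1 j x
  have hvsum : ∀ i x, ∑ A : Strata K with i ∈ A.1, v i A x = 1 := fun i x =>
    sum_condSetWeight (fun j => hh1 j x) i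
  -- The weight is read off at the perturbed point `q.1`, where the `h j` are defined.
  let σ : Fin K → Strata K → Measure (X × X) := fun i A => (π i).withDensity fun q => v i A q.1
  have hσfin : ∀ i A, IsFiniteMeasure (σ i A) := fun i A =>
    isFiniteMeasure_withDensity_le_one _ fun q => hv1 i A q.1
  have hσsum : ∀ i, ∑ A : Strata K with i ∈ A.1, σ i A = π i := by
    intro i
    refine (sum_withDensity _ _ fun A => (hv i A).comp measurable_fst).trans ?_
    simp only [Function.comp_apply, hvsum]
    exact withDensity_one
  have hσfst : ∀ A : Strata K, ∀ i ∈ A.1, (σ i A).map Prod.fst = lam.withDensity (w A) := by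
    intro A i hi
    rw [map_withDensity_comp _ measurable_fst (hv i A), (hπ i).1, ← hdens i,
      ← withDensity_mul _ (hh i) (hv i A)]
    congr 1
    ext x
    exact mul_condSetWeight (fun j => h j x) hi
  refine ⟨(fun A => lam.withDensity (w A), fun i A => (σ i A).map Prod.snd),
    ⟨fun A => ?_, fun i A => ?_, fun i => ?_⟩, ?_⟩
  · exact isFiniteMeasure_withDensity_le_one _ fun x =>
      (Finset.single_le_sum (f := fun A => w A x) (fun _ _ => zero_le) (Finset.mem_univ A)).trans
        (hw1 x)
  · dsimp only
    infer_instance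
  · dsimp only
    rw [← Measure.map_finset_sum measurable_snd.aemeasurable, hσsum, (hπ i).2]
  · simp only [stratified, Finset.sum_add_distrib]
    refine add_le_add ?_ ?_
    · rw [← Measure.finsetSum_apply, sum_withDensity _ _ hw]
      exact ((withDensity_mono (Eventually.of_forall hw1)).trans_eq
        (by exact withDensity_one) : _ ≤ lam) Set.univ
    · calc ∑ A : Strata K, ∑ i ∈ A.1,
            transportCost c (lam.withDensity (w A)) ((σ i A).map Prod.snd)
          ≤ ∑ A : Strata K, ∑ i ∈ A.1, ∫⁻ q, c q.1 q.2 ∂(σ i A) :=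
            Finset.sum_le_sum fun A _ => Finset.sum_le_sum fun i hi =>
              transportCost_le ⟨hσfst A i hi, rfl⟩
        _ = ∑ i, ∑ A : Strata K with i ∈ A.1, ∫⁻ q, c q.1 q.2 ∂(σ i A) := sum_strata_comm _
        _ = ∑ i, ∫⁻ q, c q.1 q.2 ∂(π i) := by
            refine Finset.sum_congr rfl fun i _ => ?_
            rw [← lintegral_finsetSum_measure, hσsum]
        _ ≤ _ := le_rfl

theorem generalizedBarycenter_convertsTo [MetricSpace X] [CompleteSpace X]
    [SecondCountableTopology X] [BorelSpace X] {c : X → X → ℝ≥0∞}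
    (hc : LowerSemicontinuous fun q : X × X => c q.1 q.2) (μ : Fin K → Measure X)
    [∀ i, IsFiniteMeasure (μ i)] :
    (generalizedBarycenter c μ).ConvertsTo (stratified c μ) := by
  rintro ⟨lam, ρ⟩ ⟨hlam, hρ, hle⟩
  dsimp only at hlam hρ hle
  by_cases hfin : ∀ i, transportCost c (ρ i) (μ i) ≠ ∞
  · choose π hπ hπc using fun i => exists_optimal_coupling hc (ρ i) (μ i) (hfin i)
    obtain ⟨p, hp, hobj⟩ := exists_stratified_le c hle π hπ
    refine ⟨p, hp, hobj.trans (le_of_eq ?_)⟩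
    simp only [hπc, generalizedBarycenter]
  · push Not at hfin
    obtain ⟨i, hi⟩ := hfin
    obtain ⟨p, hp⟩ := stratified_feasible_nonempty c μ
    refine ⟨p, hp, le_top.trans (top_le_iff.2 ?_).ge⟩
    exact ENNReal.add_eq_top.2 (Or.inr (ENNReal.sum_eq_top.2 ⟨i, Finset.mem_univ i, hi⟩))

/-- Take `λ = ∑ λ_A` and let `μ̃_i` be the part with `A ∋ i`; subadditivity of transport bounds the
cost. -/
theorem stratified_convertsTo_generalizedBarycenter (c : X → X → ℝ≥0∞) (μ : Fin K → Measure X) :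
    (stratified c μ).ConvertsTo (generalizedBarycenter c μ) := by
  rintro ⟨lam, ρ⟩ ⟨hlam, hρ, hsum⟩
  dsimp only at hlam hρ hsum
  refine ⟨(∑ A, lam A, fun i => ∑ A : Strata K with i ∈ A.1, lam A),
    ⟨?_, fun i => ?_, fun i => ?_⟩, ?_⟩
  · dsimp only
    infer_instance
  · dsimp only
    infer_instance
  · refine Measure.le_iff'.2 fun s => ?_
    simp only [Measure.finsetSum_apply]
    exact Finset.sum_le_sum_of_subset (Finset.filter_subset _ _)
  · simp only [stratified, generalizedBarycenter, Finset.sum_add_distrib, Measure.finsetSum_apply]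
    gcongr
    rw [sum_strata_comm]
    refine Finset.sum_le_sum fun i _ => ?_
    rw [← hsum i]
    exact transportCost_sum_le _ _ _ _

end Stratified

/-! ### The stratified problem and the multimarginal problem -/

section BarycenterCost

theorem sum_cost_of_mem_barycenterSet {X : Type*} {K : ℕ} {c : X → X → ℝ≥0∞}
    {A : Strata K} {x : Fin K → X} {y : X}
    (h : y ∈ barycenterSet c A x) : ∑ i ∈ A.1, c y (x i) = stratumCost c A x :=
  le_antisymm (le_iInf h) (iInf_le _ y)

theorem stratumCost_singleton {X : Type*} {K : ℕ} {c : X → X → ℝ≥0∞} (hc : ∀ x, c x x = 0)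
    (i : Fin K) (x : Fin K → X) :
    stratumCost c ⟨{i}, Finset.singleton_nonempty i⟩ x = 0 :=
  le_antisymm ((iInf_le _ (x i)).trans (by simp [hc])) zero_le

variable {X : Type*} [MetricSpace X] {K : ℕ} {c : X → X → ℝ≥0∞}

theorem lowerSemicontinuous_sum_cost (hc : LowerSemicontinuous fun q : X × X => c q.1 q.2)
    (A : Finset (Fin K)) : LowerSemicontinuous
      (Function.uncurry fun (x : Fin K → X) (y : X) => ∑ i ∈ A, c y (x i)) :=
  lowerSemicontinuous_sum (f := fun i (q : (Fin K → X) × X) => c q.2 (q.1 i)) fun i _ =>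
    hc.comp (by fun_prop : Continuous fun q : (Fin K → X) × X => (q.2, q.1 i))

/-- A single index of the nonempty set `A` suffices: its cost stays bounded along a convergent,
hence bounded, sequence of data points. -/
theorem coercive_sum_cost (hc : IsAdmissibleCost c) (A : Strata K) :
    Coercive fun (x : Fin K → X) (y : X) => ∑ i ∈ A.1, c y (x i) := by
  intro x x₀ y M hx hM h
  obtain ⟨i, hi⟩ := A.2
  have hxi : Tendsto (fun n => x n i) atTop (𝓝 (x₀ i)) := tendsto_pi_nhds.1 hx i
  have hsup : ⨆ n, c (y n) (x n i) < ∞ := by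
    refine lt_of_le_of_lt (iSup_le fun n => ?_) hM
    exact (Finset.single_le_sum (f := fun i => c (y n) (x n i)) (fun _ _ => zero_le) hi).trans
      (h n)
  have hcomp := hc.precompact (fun n => x n i) y (Metric.isBounded_range_of_tendsto _ hxi) hsup
  obtain ⟨z, -, φ, hφ, hlim⟩ := hcomp.tendsto_subseq
    (x := fun n => (y n, x n i)) fun n => subset_closure (Set.mem_range_self n)
  exact ⟨z.1, φ, hφ, (continuous_fst.tendsto z).comp hlim⟩

theorem lowerSemicontinuous_stratumCost (hc : IsAdmissibleCost c) (A : Strata K) :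
    LowerSemicontinuous (stratumCost c A : (Fin K → X) → ℝ≥0∞) := by
  have := (coercive_sum_cost hc A).lowerSemicontinuous_iInf
    (lowerSemicontinuous_sum_cost hc.lsc A.1) isClosed_univ
  simp only [Set.mem_univ, iInf_pos] at this
  exact this

theorem exists_measurable_barycenter [CompleteSpace X] [SecondCountableTopology X]
    [MeasurableSpace X] [BorelSpace X] (hc : IsAdmissibleCost c) (A : Strata K) :
    ∃ f : (Fin K → X) → X, Measurable f ∧ ∀ x, f x ∈ barycenterSet c A x :=
  (coercive_sum_cost hc A).exists_measurable_argmin (lowerSemicontinuous_sum_cost hc.lsc A.1)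
    -- `X` may be empty; a configuration `x` itself supplies a point.
    fun x => ⟨x A.2.choose⟩

end BarycenterCost

/-! ### Conversion between strata and multimarginal plans -/

section Multimarginal

variable {X : Type*} [MeasurableSpace X] {K : ℕ}

theorem multimarginal_feasible_nonempty (c : X → X → ℝ≥0∞) (μ : Fin K → Measure X)
    [∀ i, IsFiniteMeasure (μ i)] : (multimarginal c μ).feasible.Nonempty := by
  classical
  refine ⟨fun A => ∑ i, if A.1 = {i} then (μ i).map (fun x _ => x) else 0, fun A => ?_,
    fun i => ?_⟩
  · have : ∀ i, IsFiniteMeasure (if A.1 = {i} then (μ i).map (fun x (_ : Fin K) => x) else 0) := by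
      intro i
      split_ifs <;> infer_instance
    dsimp only
    infer_instance
  · rw [Finset.sum_eq_single ⟨{i}, Finset.singleton_nonempty i⟩]
    · dsimp only
      rw [Finset.sum_eq_single i]
      · rw [if_pos rfl, Measure.map_map (measurable_pi_apply i) (by fun_prop)]
        exact Measure.map_id
      · intro j _ hj
        exact if_neg fun h => hj (Finset.singleton_injective h).symm
      · simp
    · intro A hA hne
      have : ∀ j, A.1 ≠ {j} := by
        intro j hj
        have hi := (Finset.mem_filter.1 hA).2
        rw [hj, Finset.mem_singleton] at hi
        exact hne (Subtype.ext (hi ▸ hj))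
      simp [this]
    · simp

variable [MetricSpace X] [SecondCountableTopology X] [BorelSpace X] {c : X → X → ℝ≥0∞}

/-- The image of `π_A` under `x ↦ (f_A x, x_i)` is an admissible plan; summed over `i ∈ A`, the
integrand is exactly `c_A`. -/
theorem stratified_of_multimarginal (hc : IsAdmissibleCost c) (μ : Fin K → Measure X)
    {π : Strata K → Measure (Fin K → X)} (hπ : π ∈ (multimarginal c μ).feasible)
    {f : Strata K → (Fin K → X) → X} (hf : ∀ A, AEMeasurable (f A) (π A))
    (hmin : ∀ A x, f A x ∈ barycenterSet c A x) :
    ((fun A => (π A).map (f A)), (fun i A => (π A).map (fun x => x i))) ∈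
        (stratified c μ).feasible ∧
      (stratified c μ).objective
          ((fun A => (π A).map (f A)), (fun i A => (π A).map (fun x => x i))) ≤
        (multimarginal c μ).objective π := by
  obtain ⟨hfin, hsum⟩ := hπ
  refine ⟨⟨fun A => ?_, fun i A => ?_, hsum⟩, ?_⟩
  · dsimp only
    infer_instance
  · dsimp only
    infer_instance
  simp only [stratified, multimarginal]
  refine Finset.sum_le_sum fun A _ => ?_
  have hmeas : Measurable (stratumCost c A : (Fin K → X) → ℝ≥0∞) :=
    (lowerSemicontinuous_stratumCost hc A).measurable
  rw [lintegral_add_right _ measurable_const, lintegral_one, add_comm,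
    Measure.map_apply_of_aemeasurable (hf A) MeasurableSet.univ, Set.preimage_univ]
  gcongr
  have hpair : ∀ i, AEMeasurable (fun x => (f A x, x i)) (π A) := fun i =>
    (hf A).prodMk (measurable_pi_apply i).aemeasurable
  calc ∑ i ∈ A.1, transportCost c ((π A).map (f A)) ((π A).map fun x => x i)
      ≤ ∑ i ∈ A.1, ∫⁻ x, c (f A x) (x i) ∂(π A) := by
        refine Finset.sum_le_sum fun i _ =>
          (transportCost_le (π := (π A).map fun x => (f A x, x i)) ⟨?_, ?_⟩).trans
            (lintegral_map_le _ _)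
        · exact AEMeasurable.map_map_of_aemeasurable measurable_fst.aemeasurable (hpair i)
        · exact AEMeasurable.map_map_of_aemeasurable measurable_snd.aemeasurable (hpair i)
    _ = ∫⁻ x, ∑ i ∈ A.1, c (f A x) (x i) ∂(π A) :=
        (lintegral_finsetSum' _ fun i _ => hc.lsc.measurable.comp_aemeasurable (hpair i)).symm
    _ = ∫⁻ x, stratumCost c A x ∂(π A) :=
        lintegral_congr fun x => sum_cost_of_mem_barycenterSet (hmin A x)

theorem multimarginal_convertsTo_stratified [CompleteSpace X] (hc : IsAdmissibleCost c)
    (μ : Fin K → Measure X) : (multimarginal c μ).ConvertsTo (stratified c μ) := by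
  intro π hπ
  choose f hf hmin using fun A : Strata K => exists_measurable_barycenter hc A
  have := stratified_of_multimarginal hc μ hπ (fun A => (hf A).aemeasurable) hmin
  exact ⟨_, this.1, this.2⟩

theorem exists_isGluing [CompleteSpace X] (A : Strata K) (G : Fin K → Measure (X × X))
    (ρ : Measure X) [IsFiniteMeasure ρ] (hG : ∀ i ∈ A.1, (G i).map Prod.fst = ρ) :
    ∃ Γ : Measure ((Fin K → X) × X), IsGluing A G Γ := by
  -- The default kernels in `exists_gluing` require a point; on an empty space all measures
  -- coincide.
  rcases isEmpty_or_nonempty X with hX | hX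
  · exact ⟨0, fun i _ => Subsingleton.elim _ _⟩
  · exact exists_gluing A.1 G ρ hG

/-- Under the gluing, `x'` is a competitor in the infimum defining `c_A(x)`; integrating the
comparison gives the bound. -/
theorem multimarginal_of_stratified (hc : IsAdmissibleCost c) {μ : Fin K → Measure X}
    {p : (Strata K → Measure X) × (Fin K → Strata K → Measure X)}
    (hp : p ∈ (stratified c μ).feasible) {G : Strata K → Fin K → Measure (X × X)}
    (hG : ∀ A : Strata K, ∀ i ∈ A.1, G A i ∈ couplings (p.1 A) (p.2 i A) ∧
      ∫⁻ q, c q.1 q.2 ∂(G A i) = transportCost c (p.1 A) (p.2 i A))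
    {Γ : Strata K → Measure ((Fin K → X) × X)} (hΓ : ∀ A, IsGluing A (G A) (Γ A)) :
    (fun A => (Γ A).map Prod.fst) ∈ (multimarginal c μ).feasible ∧
      (multimarginal c μ).objective (fun A => (Γ A).map Prod.fst) ≤
        (stratified c μ).objective p := by
  obtain ⟨hfin, -, hsum⟩ := hp
  have hproj : ∀ i : Fin K, Measurable fun q : (Fin K → X) × X => (q.2, q.1 i) := fun i => by
    fun_prop
  -- Since `A` is nonempty, some pair marginal is prescribed and fixes the total mass.
  have huniv : ∀ A, Γ A Set.univ = p.1 A Set.univ := by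
    intro A
    obtain ⟨i, hi⟩ := A.2
    rw [← coupling_univ_left (hG A i hi).1, ← hΓ A i hi,
      Measure.map_apply (hproj i) MeasurableSet.univ, Set.preimage_univ]
  have hΓfin : ∀ A, IsFiniteMeasure (Γ A) := fun A =>
    ⟨by rw [huniv A]; exact measure_lt_top _ _⟩
  refine ⟨⟨fun A => ?_, fun i => ?_⟩, ?_⟩
  · dsimp only
    infer_instance
  · rw [← hsum i]
    refine Finset.sum_congr rfl fun A hA => ?_
    have hi := (Finset.mem_filter.1 hA).2
    rw [← (hG A i hi).1.2, ← hΓ A i hi, Measure.map_map (measurable_pi_apply i) measurable_fst,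
      Measure.map_map measurable_snd (hproj i)]
    rfl
  · simp only [stratified, multimarginal]
    refine Finset.sum_le_sum fun A _ => (lintegral_map_le _ _).trans ?_
    rw [lintegral_add_right _ measurable_const, lintegral_one, huniv, add_comm]
    gcongr
    calc ∫⁻ q, stratumCost c A q.1 ∂(Γ A) ≤ ∫⁻ q, ∑ i ∈ A.1, c q.2 (q.1 i) ∂(Γ A) :=
          lintegral_mono fun q => iInf_le _ q.2
      _ = ∑ i ∈ A.1, ∫⁻ q, c q.2 (q.1 i) ∂(Γ A) :=
          lintegral_finsetSum _ fun i _ => hc.lsc.measurable.comp (hproj i)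
      _ = ∑ i ∈ A.1, transportCost c (p.1 A) (p.2 i A) := by
          refine Finset.sum_congr rfl fun i hi => ?_
          rw [← (hG A i hi).2, ← hΓ A i hi, lintegral_map hc.lsc.measurable (hproj i)]

theorem stratified_convertsTo_multimarginal [CompleteSpace X] (hc : IsAdmissibleCost c)
    (μ : Fin K → Measure X) [∀ i, IsFiniteMeasure (μ i)] :
    (stratified c μ).ConvertsTo (multimarginal c μ) := by
  intro p hp
  have hfin := hp.1
  by_cases htop : ∀ A : Strata K, ∀ i ∈ A.1, transportCost c (p.1 A) (p.2 i A) ≠ ∞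
  · have hex : ∀ (A : Strata K) (i : Fin K), ∃ π : Measure (X × X), i ∈ A.1 →
        π ∈ couplings (p.1 A) (p.2 i A) ∧
          ∫⁻ q, c q.1 q.2 ∂π = transportCost c (p.1 A) (p.2 i A) := by
      intro A i
      by_cases hi : i ∈ A.1
      · obtain ⟨π, hπ, hπc⟩ := exists_optimal_coupling hc.lsc (p.1 A) (p.2 i A) (htop A i hi)
        exact ⟨π, fun _ => ⟨hπ, hπc⟩⟩
      · exact ⟨0, fun h => (hi h).elim⟩
    choose G hG using hex
    choose Γ hΓ using fun A => exists_isGluing A (G A) (p.1 A) fun i hi => (hG A i hi).1.1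
    have := multimarginal_of_stratified hc hp hG hΓ
    exact ⟨_, this.1, this.2⟩
  · push Not at htop
    obtain ⟨A, i, hi, hA⟩ := htop
    obtain ⟨q, hq⟩ := multimarginal_feasible_nonempty c μ
    refine ⟨q, hq, le_top.trans (top_le_iff.2 ?_).ge⟩
    refine ENNReal.sum_eq_top.2 ⟨A, Finset.mem_univ A, ENNReal.add_eq_top.2 (Or.inr ?_)⟩
    exact ENNReal.sum_eq_top.2 ⟨i, hi, hA⟩

end Multimarginal

/-! ### The multimarginal problem and the single-coupling problem -/

section LinearProgram

variable {X : Type*} {K : ℕ}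

/-- The feasible points `(p, m)` of the linear program in the definition of `singleCost`. -/
def massConstraint (X : Type*) (K : ℕ) : Set ((Fin K → X × unitInterval) × (Strata K → ℝ≥0)) :=
  {q | ∀ i, ∑ A : Strata K with i ∈ A.1, (q.2 A : ℝ) = ((q.1 i).2 : ℝ)}

/-- The objective of the linear program in the definition of `singleCost`, with the value `∞`
at infeasible points. -/
noncomputable def massCost (c : X → X → ℝ≥0∞) (p : Fin K → X × unitInterval) (m : Strata K → ℝ≥0) :
    ℝ≥0∞ :=
  ∑ A : Strata K, (m A : ℝ≥0∞) * (stratumCost c A (fun i => (p i).1) + 1) +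
    (massConstraint X K)ᶜ.indicator (fun _ => ∞) (p, m)

theorem massCost_of_mem (c : X → X → ℝ≥0∞) {p : Fin K → X × unitInterval} {m : Strata K → ℝ≥0}
    (h : (p, m) ∈ massConstraint X K) :
    massCost c p m = ∑ A : Strata K, (m A : ℝ≥0∞) * (stratumCost c A (fun i => (p i).1) + 1) := by
  simp [massCost, h]

theorem mem_massConstraint_of_ne_top {c : X → X → ℝ≥0∞} {p : Fin K → X × unitInterval}
    {m : Strata K → ℝ≥0} (h : massCost c p m ≠ ∞) : (p, m) ∈ massConstraint X K := by
  by_contra hm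
  simp [massCost, hm] at h

/-- For `i ∈ A`, `m A` is one term of a sum equal to `r_i ≤ 1`. Feasible points thus lie in a cube,
which gives coercivity. -/
theorem le_one_of_mem_massConstraint {p : Fin K → X × unitInterval} {m : Strata K → ℝ≥0}
    (h : (p, m) ∈ massConstraint X K) (A : Strata K) : m A ≤ 1 := by
  obtain ⟨i, hi⟩ := A.2
  have h1 : (m A : ℝ) ≤ ∑ A : Strata K with i ∈ A.1, (m A : ℝ) :=
    Finset.single_le_sum (f := fun A => (m A : ℝ)) (fun _ _ => NNReal.coe_nonneg _)
      (Finset.mem_filter.2 ⟨Finset.mem_univ A, hi⟩)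
  have h2 := h i
  dsimp only at h2
  exact_mod_cast h1.trans (h2.le.trans (p i).2.2.2)

/-- Putting mass `r_i` on each singleton `{i}` costs no transport, since `c x x = 0`. Minimizers of
the penalized cost therefore satisfy the constraint. -/
theorem exists_massCost_ne_top {c : X → X → ℝ≥0∞} (hc : ∀ x, c x x = 0)
    (p : Fin K → X × unitInterval) : ∃ m : Strata K → ℝ≥0, massCost c p m ≠ ∞ := by
  classical
  let m : Strata K → ℝ≥0 := fun A =>
    ∑ i, if A.1 = {i} then ((p i).2 : ℝ).toNNReal else 0
  have hm : (p, m) ∈ massConstraint X K := by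
    intro i
    rw [Finset.sum_eq_single ⟨{i}, Finset.singleton_nonempty i⟩]
    · dsimp only [m]
      rw [Finset.sum_eq_single i]
      · rw [if_pos rfl, Real.coe_toNNReal _ (p i).2.2.1]
      · intro j _ hj
        exact if_neg fun h => hj (Finset.singleton_injective h).symm
      · simp
    · intro A hA hne
      have : ∀ j, A.1 ≠ {j} := by
        intro j hj
        have hi := (Finset.mem_filter.1 hA).2
        rw [hj, Finset.mem_singleton] at hi
        exact hne (Subtype.ext (hi ▸ hj))
      simp [m, this]
    · simp
  refine ⟨m, ?_⟩
  rw [massCost_of_mem c hm]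
  refine ENNReal.sum_ne_top.2 fun A _ => ?_
  by_cases hA : ∃ i, A.1 = {i}
  · obtain ⟨i, hi⟩ := hA
    obtain rfl : A = ⟨{i}, Finset.singleton_nonempty i⟩ := Subtype.ext hi
    rw [stratumCost_singleton hc]
    simp
  · push Not at hA
    simp [m, hA]

variable [MetricSpace X] {c : X → X → ℝ≥0∞}

theorem isClosed_massConstraint : IsClosed (massConstraint X K) := by
  simp only [massConstraint, Set.ofPred_forall]
  exact isClosed_iInter fun i => isClosed_eq (by fun_prop) (by fun_prop)

theorem lowerSemicontinuous_massCost (hc : IsAdmissibleCost c) :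
    LowerSemicontinuous (Function.uncurry
      (massCost c : (Fin K → X × unitInterval) → (Strata K → ℝ≥0) → ℝ≥0∞)) := by
  refine LowerSemicontinuous.add (lowerSemicontinuous_sum
    (f := fun A (q : (Fin K → X × unitInterval) × (Strata K → ℝ≥0)) =>
      (q.2 A : ℝ≥0∞) * (stratumCost c A (fun i => (q.1 i).1) + 1)) fun A _ => ?_)
    (isClosed_massConstraint.isOpen_compl.lowerSemicontinuous_indicator zero_le)
  refine lowerSemicontinuous_mul (Continuous.lowerSemicontinuous (by fun_prop)) ?_
  refine LowerSemicontinuous.add ?_ lowerSemicontinuous_const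
  exact (lowerSemicontinuous_stratumCost hc A).comp (by fun_prop :
    Continuous fun (q : (Fin K → X × unitInterval) × (Strata K → ℝ≥0)) i => (q.1 i).1)

theorem coercive_massCost :
    Coercive (massCost c : (Fin K → X × unitInterval) → (Strata K → ℝ≥0) → ℝ≥0∞) := by
  intro p p₀ m M _ hM h
  have hmem : ∀ n, m n ∈ Set.Icc (0 : Strata K → ℝ≥0) 1 := fun n =>
    ⟨fun _ => zero_le, fun A => le_one_of_mem_massConstraint
      (mem_massConstraint_of_ne_top ((h n).trans_lt hM).ne) A⟩
  obtain ⟨m₀, -, φ, hφ, hlim⟩ := isCompact_Icc.tendsto_subseq hmem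
  exact ⟨m₀, φ, hφ, hlim⟩

/-- The linear program defining `singleCost` has solutions depending on the point in a Borel
way. -/
theorem exists_measurable_singleCost_eq [SecondCountableTopology X] [MeasurableSpace X]
    [BorelSpace X] (hc : IsAdmissibleCost c) :
    ∃ m : (Fin K → X × unitInterval) → Strata K → ℝ≥0, Measurable m ∧
      (∀ p, (p, m p) ∈ massConstraint X K) ∧
      ∀ p, ∑ A : Strata K, (m p A : ℝ≥0∞) * (stratumCost c A (fun i => (p i).1) + 1) =
        singleCost c p := by
  obtain ⟨m, hm, hmin⟩ := (coercive_massCost (c := c) (K := K)).exists_measurable_argmin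
    (lowerSemicontinuous_massCost hc) fun _ => inferInstance
  have hmem : ∀ p, (p, m p) ∈ massConstraint X K := by
    intro p
    obtain ⟨m', hm'⟩ := exists_massCost_ne_top hc.diag p
    exact mem_massConstraint_of_ne_top ((hmin p m').trans_lt (lt_top_iff_ne_top.2 hm')).ne
  refine ⟨m, hm, hmem, fun p => le_antisymm ?_ (iInf₂_le (m p) (hmem p))⟩
  refine le_iInf₂ fun m' hm' => ?_
  rw [← massCost_of_mem c (hmem p),
    ← massCost_of_mem c (show (p, m') ∈ massConstraint X K from hm')]
  exact hmin p m'

end LinearProgram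

/-! ### Conversion between multimarginal plans and single couplings -/

section SingleCoupling

variable {X : Type*} {K : ℕ}

theorem singleCost_indicator_le (c : X → X → ℝ≥0∞) (A : Strata K) (x : Fin K → X) :
    singleCost c (fun i => (x i, if i ∈ A.1 then 1 else 0)) ≤ stratumCost c A x + 1 := by
  classical
  refine (iInf₂_le (Pi.single A 1 : Strata K → ℝ≥0) ?_).trans (le_of_eq ?_)
  · intro i
    by_cases hi : i ∈ A.1
    · rw [Finset.sum_eq_single A] <;> simp +contextual [hi]
    · rw [Finset.sum_eq_zero]
      · simp [hi]
      · intro B hB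
        have hne : B ≠ A := fun h => hi (h ▸ (Finset.mem_filter.1 hB).2)
        simp [hne]
  · rw [Finset.sum_eq_single A] <;> simp +contextual

variable [MeasurableSpace X]

/-- Placing `π_A` at `r = 1_A` makes the weight `r_i` keep exactly the strata containing `i`. -/
theorem multimarginal_convertsTo_singleCoupling (c : X → X → ℝ≥0∞) (μ : Fin K → Measure X) :
    (multimarginal c μ).ConvertsTo (singleCoupling c μ) := by
  classical
  rintro π ⟨hfin, hsum⟩
  let e : Strata K → (Fin K → X) → Fin K → X × unitInterval := fun A x i =>
    (x i, if i ∈ A.1 then 1 else 0)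
  have he : ∀ A, Measurable (e A) := fun A => measurable_pi_iff.2 fun i =>
    (measurable_pi_apply i).prodMk measurable_const
  have hr : ∀ i, Measurable fun p : Fin K → X × unitInterval =>
      ENNReal.ofReal ((p i).2 : ℝ) := fun i => by fun_prop
  have hx : ∀ i, Measurable fun p : Fin K → X × unitInterval => (p i).1 := fun i => by fun_prop
  refine ⟨∑ A, (π A).map (e A), ⟨?_, fun i => ?_⟩, ?_⟩
  · infer_instance
  · ext E hE
    rw [← hsum i, Measure.map_apply (hx i) hE, withDensity_apply _ (hx i hE),
      Measure.finsetSum_apply, Finset.sum_filter, ← lintegral_indicator (hx i hE),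
      lintegral_finsetSum_measure]
    refine Finset.sum_congr rfl fun A _ => ?_
    rw [lintegral_indicator (hx i hE), setLIntegral_map (hx i hE) (hr i) (he A)]
    by_cases hi : i ∈ A.1
    · simp only [e, hi, if_true, Set.Icc.coe_one, ENNReal.ofReal_one, setLIntegral_one]
      rw [Measure.map_apply (measurable_pi_apply i) hE]
      rfl
    · simp [e, hi]
  · simp only [singleCoupling, multimarginal, lintegral_finsetSum_measure]
    exact Finset.sum_le_sum fun A _ => (lintegral_map_le _ _).trans
      (lintegral_mono fun x => singleCost_indicator_le c A x)

theorem singleCoupling_convertsTo [MetricSpace X] [SecondCountableTopology X] [BorelSpace X]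
    {c : X → X → ℝ≥0∞} (hc : IsAdmissibleCost c) (μ : Fin K → Measure X) :
    (singleCoupling c μ).ConvertsTo (multimarginal c μ) := by
  rintro γ ⟨hfin, hμ⟩
  obtain ⟨m, hm, hmem, hcost⟩ := exists_measurable_singleCost_eq (K := K) hc
  have hmA : ∀ A, Measurable fun p => (m p A : ℝ≥0∞) := fun A =>
    (measurable_pi_iff.1 hm A).coe_nnreal_ennreal
  have hx : Measurable fun (p : Fin K → X × unitInterval) i => (p i).1 := by fun_prop
  have hxi : ∀ i, Measurable fun p : Fin K → X × unitInterval => (p i).1 := fun i => by fun_prop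
  have hstr : ∀ A : Strata K, Measurable fun x : Fin K → X => stratumCost c A x + 1 := fun A =>
    (lowerSemicontinuous_stratumCost hc A).measurable.add measurable_const
  have hσ : ∀ A, IsFiniteMeasure (γ.withDensity fun p => (m p A : ℝ≥0∞)) := fun A =>
    isFiniteMeasure_withDensity_le_one γ fun p => by
      exact_mod_cast le_one_of_mem_massConstraint (hmem p) A
  refine ⟨fun A => (γ.withDensity fun p => (m p A : ℝ≥0∞)).map fun p i => (p i).1,
    ⟨fun A => ?_, fun i => ?_⟩, ?_⟩
  · dsimp only
    infer_instance
  · rw [← hμ i]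
    -- The program's constraint writes the weight `r_i` as the sum of the `m_A` with `A ∋ i`, so the
    -- marginal condition becomes the multimarginal one.
    have hdens : (fun p : Fin K → X × unitInterval => ENNReal.ofReal ((p i).2 : ℝ)) =
        fun p => ∑ A : Strata K with i ∈ A.1, (m p A : ℝ≥0∞) := by
      ext p
      have := hmem p i
      dsimp only at this
      rw [← this, ENNReal.ofReal_sum_of_nonneg fun _ _ => NNReal.coe_nonneg _]
      simp
    rw [hdens, ← sum_withDensity _ _ hmA, Measure.map_finset_sum (hxi i).aemeasurable]
    refine Finset.sum_congr rfl fun A _ => ?_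
    rw [Measure.map_map (measurable_pi_apply i) hx]
    rfl
  · simp only [singleCoupling, multimarginal]
    refine le_of_eq ?_
    calc ∑ A : Strata K, ∫⁻ x, (stratumCost c A x + 1)
          ∂((γ.withDensity fun p => (m p A : ℝ≥0∞)).map fun p i => (p i).1)
        = ∑ A : Strata K, ∫⁻ p, (m p A : ℝ≥0∞) * (stratumCost c A (fun i => (p i).1) + 1) ∂γ := by
          refine Finset.sum_congr rfl fun A _ => ?_
          rw [lintegral_map (hstr A) hx]
          exact lintegral_withDensity_eq_lintegral_mul _ (hmA A) ((hstr A).comp hx)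
      _ = ∫⁻ p, ∑ A : Strata K, (m p A : ℝ≥0∞) * (stratumCost c A (fun i => (p i).1) + 1) ∂γ :=
          (lintegral_finsetSum _ fun A _ => (hmA A).mul ((hstr A).comp hx)).symm
      _ = ∫⁻ p, singleCost c p ∂γ := lintegral_congr hcost

end SingleCoupling

end AdvMOT

/-! ### Assembly of the conversions -/

theorem mainTheorem4 {X : Type*} [MetricSpace X] [CompleteSpace X] [SecondCountableTopology X]
    [MeasurableSpace X] [BorelSpace X] {K : ℕ} (hK : 2 ≤ K)
    (c : X → X → ENNReal) (hc : AdvMOT.IsAdmissibleCost c)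
    (μ : MeasureTheory.Measure (X × Fin K)) [MeasureTheory.IsFiniteMeasure μ] :
    -- the five problems are equivalent, and have the same value
    (AdvMOT.dualAdversarial c μ).Equivalent
      (AdvMOT.generalizedBarycenter c (AdvMOT.classPart μ)) ∧
    (AdvMOT.generalizedBarycenter c (AdvMOT.classPart μ)).Equivalent
      (AdvMOT.stratified c (AdvMOT.classPart μ)) ∧
    (AdvMOT.stratified c (AdvMOT.classPart μ)).Equivalent
      (AdvMOT.multimarginal c (AdvMOT.classPart μ)) ∧
    (AdvMOT.multimarginal c (AdvMOT.classPart μ)).Equivalent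
      (AdvMOT.singleCoupling c (AdvMOT.classPart μ)) ∧
    -- measurable selections of the barycenter maps exist
    (∀ A : AdvMOT.Strata K, ∃ f : (Fin K → X) → X, Measurable f ∧
      ∀ x, f x ∈ AdvMOT.barycenterSet c A x) ∧
    -- from the multimarginal problem to the stratified problem
    (∀ π ∈ (AdvMOT.multimarginal c (AdvMOT.classPart μ)).feasible,
      ∀ f : AdvMOT.Strata K → (Fin K → X) → X,
        (∀ A, AEMeasurable (f A) (π A)) → (∀ A x, f A x ∈ AdvMOT.barycenterSet c A x) →
        ((fun A => (π A).map (f A)), (fun i A => (π A).map (fun x => x i))) ∈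
            (AdvMOT.stratified c (AdvMOT.classPart μ)).feasible ∧
          (AdvMOT.stratified c (AdvMOT.classPart μ)).objective
              ((fun A => (π A).map (f A)), (fun i A => (π A).map (fun x => x i))) ≤
            (AdvMOT.multimarginal c (AdvMOT.classPart μ)).objective π) ∧
    -- from the stratified problem to the multimarginal problem
    (∀ p ∈ (AdvMOT.stratified c (AdvMOT.classPart μ)).feasible,
      ∀ G : AdvMOT.Strata K → Fin K → MeasureTheory.Measure (X × X),
        (∀ A : AdvMOT.Strata K, ∀ i ∈ A.1,
          G A i ∈ AdvMOT.couplings (p.1 A) (p.2 i A) ∧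
          ∫⁻ q, c q.1 q.2 ∂(G A i) = AdvMOT.transportCost c (p.1 A) (p.2 i A)) →
        (∃ Γ : AdvMOT.Strata K → MeasureTheory.Measure ((Fin K → X) × X),
          ∀ A, AdvMOT.IsGluing A (G A) (Γ A)) ∧
        ∀ Γ : AdvMOT.Strata K → MeasureTheory.Measure ((Fin K → X) × X),
          (∀ A, AdvMOT.IsGluing A (G A) (Γ A)) →
          (fun A => (Γ A).map Prod.fst) ∈
              (AdvMOT.multimarginal c (AdvMOT.classPart μ)).feasible ∧
            (AdvMOT.multimarginal c (AdvMOT.classPart μ)).objective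
                (fun A => (Γ A).map Prod.fst) ≤
              (AdvMOT.stratified c (AdvMOT.classPart μ)).objective p) := by
  have : NeZero K := ⟨by omega⟩
  have := AdvMOT.isFiniteMeasure_classPart μ
  have hmeas := hc.lsc.measurable
  refine ⟨(AdvMOT.dualAdversarial_convertsTo hmeas μ).equivalent
      (AdvMOT.generalizedBarycenter_convertsTo_dualAdversarial c μ),
    (AdvMOT.generalizedBarycenter_convertsTo hc.lsc _).equivalent
      (AdvMOT.stratified_convertsTo_generalizedBarycenter c _),
    (AdvMOT.stratified_convertsTo_multimarginal hc _).equivalent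
      (AdvMOT.multimarginal_convertsTo_stratified hc _),
    (AdvMOT.multimarginal_convertsTo_singleCoupling c _).equivalent
      (AdvMOT.singleCoupling_convertsTo hc _),
    AdvMOT.exists_measurable_barycenter hc,
    fun π hπ f hf hmin => AdvMOT.stratified_of_multimarginal hc _ hπ hf hmin,
    fun p hp G hG => ⟨?_, fun Γ hΓ => AdvMOT.multimarginal_of_stratified hc hp hG hΓ⟩⟩
  have hfin := hp.1
  choose Γ hΓ using fun A => AdvMOT.exists_isGluing A (G A) (p.1 A) fun i hi => (hG A i hi).1.1
  exact ⟨Γ, hΓ⟩
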